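/- Work over $\mathbb C$; all groups are finite and all modules are finite-dimensional complex representations. A covariant of a finite group $G$ is a $G$-equivariant polynomial map (morphism) $\phi\colon V\to W$ between $G$-modules; its dimension is $\dim\overline{\phi(V)}$ (Zariski closure), and $\phi$ is faithful if $G$ acts faithfully on $\phi(V)$. The covariant dimension $\operatorname{covdim}G$ is the minimum of $\dim\phi$ over all faithful covariants $\phi$ of $G$. A group is called faithful if it admits a faithful irreducible representation. Write $Z(G)$ for the center of $G$. Let $G=G_1\times\cdots\times G_n$ ($n\ge 1$) be a product of non-trivial finite faithful groups and let $p$ be a prime. (1) If $p$ is coprime to $|Z(G)|$, then $\operatorname{covdim}(G\times\mathbb Z/p)=\operatorname{covdim}G$. (2) If $p$ divides $|Z(G_i)|$ for every $i$, then $\operatorname{covdim}(G\times(\mathbb Z/p)^m)=\operatorname{covdim}G+m$ for every $m\ge 0$. In particular, if $H$ is a non-trivial finite faithful group and $m\ge 1$, then $$\operatorname{covdim}(H\times(\mathbb Z/p)^m)=\begin{cases}\operatorname{covdim}H+m & \text{if } p \text{ divides } |Z(H)|,\\ \operatorname{covdim}H+(m-1) & \text{otherwise.}\end{cases}$$ 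-/

import Mathlib

namespace CovariantDimension

/-- The coordinate ring of a finite-dimensional complex vector space `V`: the algebra of functions
on `V` generated by the linear functionals, that is, the polynomial functions on `V`. -/
def coordRing (V : Type*) [AddCommGroup V] [Module ℂ V] : Subalgebra ℂ (V → ℂ) :=
  Algebra.adjoin ℂ (Set.range fun l : Module.Dual ℂ V => (l : V → ℂ))

/-- The ideal of all polynomial functions on `V` that vanish on `S`. -/
def vanishingIdeal {V : Type*} [AddCommGroup V] [Module ℂ V] (S : Set V) :
    Ideal (coordRing V) where
  carrier := {f | ∀ v ∈ S, (f : V → ℂ) v = 0}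
  add_mem' := by
    intro f g hf hg v hv
    simp [hf v hv, hg v hv]
  zero_mem' := by
    intro v _
    simp
  smul_mem' := by
    intro c f hf v hv
    simp [hf v hv]

/-- The Zariski closure of `S`: the common zeros of all polynomial functions vanishing on `S`. -/
def zariskiClosure {V : Type*} [AddCommGroup V] [Module ℂ V] (S : Set V) : Set V :=
  {v | ∀ f ∈ vanishingIdeal S, (f : V → ℂ) v = 0}

/-- The dimension of a Zariski closed subset `X` of `V`: the Krull dimension of its ring of
regular functions `𝒪(V) / I(X)`. -/
noncomputable def algebraicDim {V : Type*} [AddCommGroup V] [Module ℂ V] (X : Set V) :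
    WithBot ℕ∞ :=
  ringKrullDim (coordRing V ⧸ vanishingIdeal X)

/-- A map between vector spaces is a morphism of varieties if its composition with every linear
functional is a polynomial function. -/
def IsMorphism {V W : Type*} [AddCommGroup V] [Module ℂ V] [AddCommGroup W] [Module ℂ W]
    (f : V → W) : Prop :=
  ∀ l : Module.Dual ℂ W, (fun v => l (f v)) ∈ coordRing V

/-- A covariant of `G`: an equivariant morphism between two `G`-modules. -/
structure Covariant {G V W : Type*} [Group G] [AddCommGroup V] [Module ℂ V]
    [AddCommGroup W] [Module ℂ W] (ρ : Representation ℂ G V) (σ : Representation ℂ G W) where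
  toFun : V → W
  isMorphism : IsMorphism toFun
  equivariant : ∀ (g : G) (v : V), toFun (ρ g v) = σ g (toFun v)

namespace Covariant

variable {G V W : Type*} [Group G] [AddCommGroup V] [Module ℂ V] [AddCommGroup W] [Module ℂ W]
  {ρ : Representation ℂ G V} {σ : Representation ℂ G W}

/-- The dimension of a covariant is the dimension of the Zariski closure of its image. -/
noncomputable def dim (φ : Covariant ρ σ) : WithBot ℕ∞ :=
  algebraicDim (zariskiClosure (Set.range φ.toFun))

/-- A covariant is faithful if `G` acts faithfully on its image. -/
def IsFaithful (φ : Covariant ρ σ) : Prop :=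
  ∀ g : G, (∀ w ∈ Set.range φ.toFun, σ g w = w) → g = 1

end Covariant

/-- The covariant dimension of `G`: the least dimension of a faithful covariant `φ : V → W`
between finite-dimensional `G`-modules. -/
noncomputable def covdim (G : Type*) [Group G] : ℕ :=
  sInf {d : ℕ | ∃ (V W : Type) (_ : AddCommGroup V) (_ : Module ℂ V) (_ : FiniteDimensional ℂ V)
    (_ : AddCommGroup W) (_ : Module ℂ W) (_ : FiniteDimensional ℂ W)
    (ρ : Representation ℂ G V) (σ : Representation ℂ G W) (φ : Covariant ρ σ),
      φ.IsFaithful ∧ φ.dim = (d : WithBot ℕ∞)}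

/-- A group is called faithful if it has a faithful irreducible (finite-dimensional, complex)
representation. -/
def IsFaithfulGroup (G : Type*) [Group G] : Prop :=
  ∃ (V : Type) (_ : AddCommGroup V) (_ : Module ℂ V) (_ : FiniteDimensional ℂ V)
    (ρ : Representation ℂ G V), ρ.IsIrreducible ∧ Function.Injective ρ

end CovariantDimension

namespace CovariantDimension

open Cardinal

universe u

/-! Pulling coordinate functions back along a faithful covariant gives a stable subalgebra `S` of a
polynomial ring with linear `G`-action, on which `G` acts faithfully; the dimension of the covariant
is the transcendence degree of `S` (`exists_algebraicDim_eq_and_trdeg_pullback_eq`). Conversely, any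
such `S` yields a faithful covariant of no larger dimension
(`exists_covariant_of_isFaithfulSubalgebra`). So the covariant dimension is the least transcendence
degree of such an `S`.

Let `ρ j` be irreducible and jointly faithful. Independence of characters puts a nonzero equivariant
image `u j` of each into `S`, and these images already generate a faithful subalgebra. Passing to
top components for a grading preserved by `G` does not raise the transcendence degree
(`trdeg_adjoin_initial_le`), so each `u j` may be taken homogeneous.

If `p` is prime to the order of the centre, let `ℤ/p` act by scalars on the same polynomial ring. A
homogeneous `u j` of degree `d` becomes equivariant for `ρ j` twisted by `χ ^ d`, and the twisted
family is faithful as soon as one degree is prime to `p`. This is arranged by multiplying with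
powers of an invariant of degree prime to `p` (`IsFaithfulFamily.exists_degree_not_dvd`).

If `p` divides the order of every centre, there are central elements `z i` acting by a primitive
`p`-th root of unity on `ρ i` and trivially on the other members. Diagonalising them gives one
grading for each `i`. The matrix of degrees of the `u j` is the identity modulo `p`, so it is
invertible over the rationals, and some one-parameter torus moves a single `u j` while fixing the
others. Hence deleting the member carrying the character of a new factor `ℤ/p` lowers the
transcendence degree by at least one (`IsCentralFamily.exists_model_some`), while an extra variable
shows that one more dimension suffices.

For a faithful `H` whose centre has order prime to `p`, one factor is free, and `H × ℤ/p` then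
satisfies the hypotheses of the second case. -/

/-! ### Krull dimension and transcendence degree -/

theorem ringKrullDim_eq_of_isIntegral (R S : Type*) [CommRing R] [CommRing S] [Algebra R S]
    [Algebra.IsIntegral R S] (h : Function.Injective (algebraMap R S)) :
    ringKrullDim S = ringKrullDim R := by
  apply le_antisymm
  · refine Order.krullDim_le_of_strictMono (PrimeSpectrum.comap (algebraMap R S)) ?_
    intro I J hIJ
    exact Ideal.IsIntegral.comap_lt_comap (R := R) (show I.asIdeal < J.asIdeal from hIJ)
  · refine iSup_le fun l => ?_
    obtain ⟨Q, -, hQ, hQl⟩ := Ideal.exists_ideal_over_prime_of_isIntegral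
      (S := S) (l.head.asIdeal) ⊥ (by
        rw [← RingHom.ker, (RingHom.injective_iff_ker_eq_bot _).1 h]; exact bot_le)
    have : Q.LiesOver l.head.asIdeal := ⟨hQl.symm⟩
    obtain ⟨L, hL, -, -⟩ := Ideal.exists_ltSeries_of_hasGoingUp (S := S) l Q
    rw [← hL]
    exact le_iSup (fun p : LTSeries (PrimeSpectrum S) => (p.length : WithBot ℕ∞)) L

/-- Noether normalisation: `A` is integral over a polynomial ring in `n` variables, for which both
invariants equal `n`. -/
theorem exists_ringKrullDim_eq_and_trdeg_eq (k A : Type*) [Field k] [CommRing A] [IsDomain A]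
    [Algebra k A] [Algebra.FiniteType k A] :
    ∃ n : ℕ, ringKrullDim A = n ∧ Algebra.trdeg k A = n := by
  obtain ⟨n, g, hg, hgi⟩ := exists_integral_inj_algHom_of_fg k A
  refine ⟨n, ?_, ?_⟩
  · algebraize [g.toRingHom]
    have : Algebra.IsIntegral (MvPolynomial (Fin n) k) A := ⟨hgi⟩
    rw [ringKrullDim_eq_of_isIntegral (MvPolynomial (Fin n) k) A hg,
      MvPolynomial.ringKrullDim_of_isNoetherianRing, ringKrullDim_eq_zero_of_field]
    simp
  · algebraize [g.toRingHom]
    have hi : Algebra.IsIntegral (MvPolynomial (Fin n) k) A := ⟨hgi⟩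
    have : IsScalarTower k (MvPolynomial (Fin n) k) A := .of_algHom g
    have : FaithfulSMul (MvPolynomial (Fin n) k) A :=
      (faithfulSMul_iff_algebraMap_injective _ _).2 hg
    have h := ((IsTranscendenceBasis.mvPolynomial (Fin n) k).algebraMap_comp
      (A := A)).lift_cardinalMk_eq_trdeg
    simpa using h.symm

/-! ### Transcendence degree of generated algebras -/

section Trdeg

variable {k R : Type*} [Field k] [CommRing R] [IsDomain R] [Algebra k R]

/-- A transcendence basis can be chosen among the generators. Comparing two generated algebras thus
reduces to independent sets of generators. -/
theorem exists_algebraicIndependent_subset_mk_eq_trdeg_adjoin (s : Set R) :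
    ∃ t ⊆ s, AlgebraicIndependent k ((↑) : t → R) ∧ #t = Algebra.trdeg k (Algebra.adjoin k s) := by
  let A := Algebra.adjoin k s
  let s' : Set A := (↑) ⁻¹' s
  have hs' : Algebra.adjoin k s' = ⊤ := Algebra.adjoin_adjoin_coe_preimage
  have : Algebra.IsAlgebraic (Algebra.adjoin k s') A := by
    refine ⟨fun a => ?_⟩
    exact isAlgebraic_algebraMap (⟨a, hs' ▸ Algebra.mem_top⟩ : Algebra.adjoin k s')
  obtain ⟨t, hts, ht⟩ := exists_isTranscendenceBasis_subset (R := k) s'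
  refine ⟨(↑) '' t, by rintro _ ⟨x, hx, rfl⟩; exact hts hx, ?_, ?_⟩
  · have h := (AlgHom.algebraicIndependent_iff A.val Subtype.val_injective).2 ht.1
    have h2 := h.to_subtype_range
    have : Set.range (A.val ∘ ((↑) : t → A)) = (↑) '' t := by
      rw [Set.range_comp]; simp
    rwa [this] at h2
  · rw [mk_image_eq Subtype.val_injective]
    exact ht.cardinalMk_eq_trdeg

theorem trdeg_adjoin_le_of_forall (s : Set R) (c : Cardinal)
    (h : ∀ t ⊆ s, AlgebraicIndependent k ((↑) : t → R) → #t ≤ c) :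
    Algebra.trdeg k (Algebra.adjoin k s) ≤ c := by
  obtain ⟨t, hts, ht, hc⟩ := exists_algebraicIndependent_subset_mk_eq_trdeg_adjoin (k := k) s
  exact hc ▸ h t hts ht

theorem mk_le_trdeg_of_forall_mem {R : Type u} [CommRing R] [Algebra k R]
    (S : Subalgebra k R) {ι : Type u} {x : ι → R}
    (hx : AlgebraicIndependent k x) (h : ∀ i, x i ∈ S) :
    #ι ≤ Algebra.trdeg k S := by
  have : AlgebraicIndependent k (fun i => (⟨x i, h i⟩ : S)) :=
    (AlgHom.algebraicIndependent_iff S.val Subtype.val_injective).1 hx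
  exact this.cardinalMk_le_trdeg

theorem trdeg_mono {R : Type*} [CommRing R] [Algebra k R] {S T : Subalgebra k R} (h : S ≤ T) :
    Algebra.trdeg k S ≤ Algebra.trdeg k T :=
  trdeg_le_of_injective (Subalgebra.inclusion h) (Subalgebra.inclusion_injective h)

theorem trdeg_adjoin_insert_le (x : R) (s : Set R) :
    Algebra.trdeg k (Algebra.adjoin k (insert x s)) ≤ Algebra.trdeg k (Algebra.adjoin k s) + 1 := by
  refine trdeg_adjoin_le_of_forall _ _ fun t hts ht => ?_
  have h1 : AlgebraicIndependent k ((↑) : (t \ {x} : Set R) → R) :=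
    ht.comp (Set.inclusion Set.sdiff_subset) (Set.inclusion_injective _)
  have h2 : #(t \ {x} : Set R) ≤ Algebra.trdeg k (Algebra.adjoin k s) := by
    exact mk_le_trdeg_of_forall_mem (Algebra.adjoin k s) h1 fun i =>
      Algebra.subset_adjoin ((hts i.2.1).resolve_left i.2.2)
  calc #t ≤ #(insert x (t \ {x}) : Set R) := mk_le_mk_of_subset (by
        rw [Set.insert_sdiff_singleton]; exact Set.subset_insert _ _)
    _ ≤ #(t \ {x} : Set R) + 1 := mk_insert_le
    _ ≤ _ := by gcongr

end Trdeg

/-! ### Algebraic independence from leading coefficients -/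

section LeadingCoeff

variable {k A ι : Type*} [CommRing k] [CommRing A] [Algebra k A]

theorem natDegree_prod_pow_le_and_coeff (F : ι → Polynomial A) (e : ι → ℕ)
    (hF : ∀ i, (F i).natDegree ≤ e i) (m : ι → ℕ) (s : Finset ι) :
    (∏ i ∈ s, F i ^ m i).natDegree ≤ ∑ i ∈ s, m i * e i ∧
      (∏ i ∈ s, F i ^ m i).coeff (∑ i ∈ s, m i * e i) =
        ∏ i ∈ s, (F i).coeff (e i) ^ m i := by
  classical
  induction s using Finset.induction_on with
  | empty => simp
  | insert a s ha ih =>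
    rw [Finset.prod_insert ha, Finset.sum_insert ha, Finset.prod_insert ha]
    have h1 : (F a ^ m a).natDegree ≤ m a * e a := Polynomial.natDegree_pow_le_of_le _ (hF a)
    refine ⟨Polynomial.natDegree_mul_le_of_le h1 ih.1, ?_⟩
    rw [Polynomial.coeff_mul_add_eq_of_natDegree_le h1 ih.1, ih.2,
      Polynomial.coeff_pow_of_natDegree_le (hF a)]

/-- Only monomials of weight exactly `N` reach degree `N`, and there the coefficients in degree `e
i` multiply. -/
theorem coeff_aeval_of_weight_le (F : ι → Polynomial A) (e : ι → ℕ)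
    (hF : ∀ i, (F i).natDegree ≤ e i) (N : ℕ) (P : MvPolynomial ι k)
    (hP : ∀ m ∈ P.support, Finsupp.weight e m ≤ N) :
    (MvPolynomial.aeval F P).coeff N = MvPolynomial.aeval (fun i => (F i).coeff (e i))
      (MvPolynomial.weightedHomogeneousComponent e N P) := by
  classical
  rw [MvPolynomial.weightedHomogeneousComponent_apply, MvPolynomial.aeval_def,
    MvPolynomial.eval₂_eq, Polynomial.finsetSum_coeff, map_sum, Finset.sum_filter]
  refine Finset.sum_congr rfl fun m hm => ?_
  have hw : Finsupp.weight e m = ∑ i ∈ m.support, m i * e i := by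
    simp [Finsupp.weight_apply, Finsupp.sum]
  obtain ⟨h1, h2⟩ := natDegree_prod_pow_le_and_coeff F e hF m m.support
  rw [← hw] at h1 h2
  rw [Polynomial.algebraMap_apply, Polynomial.coeff_C_mul]
  split_ifs with h
  · subst h
    rw [h2, MvPolynomial.aeval_monomial, Finsupp.prod]
  · rw [Polynomial.coeff_eq_zero_of_natDegree_lt, mul_zero]
    exact h1.trans_lt (lt_of_le_of_ne (hP m hm) h)

/-- Polynomials whose leading coefficients are algebraically independent are algebraically
independent. -/
theorem algebraicIndependent_of_coeff (F : ι → Polynomial A) (e : ι → ℕ)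
    (hF : ∀ i, (F i).natDegree ≤ e i) (h : AlgebraicIndependent k fun i => (F i).coeff (e i)) :
    AlgebraicIndependent k F := by
  classical
  rw [algebraicIndependent_iff] at h ⊢
  intro P hP
  by_contra hne
  -- The part of `P` of maximal weight would be a nonzero relation between the leading coefficients.
  obtain ⟨m, hm, hmax⟩ := P.support.exists_max_image (Finsupp.weight e)
    (MvPolynomial.support_nonempty.2 hne)
  have h1 := coeff_aeval_of_weight_le F e hF _ P hmax
  rw [hP, Polynomial.coeff_zero] at h1
  have h2 := congrArg (MvPolynomial.coeff m) (h _ h1.symm)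
  rw [MvPolynomial.coeff_weightedHomogeneousComponent, if_pos rfl, MvPolynomial.coeff_zero] at h2
  exact MvPolynomial.mem_support_iff.1 hm h2

end LeadingCoeff

/-! ### Weight gradings and diagonal substitutions -/

section Weight

variable {k σ : Type*} [CommRing k]

/-- The coaction of the one-parameter group of weight `w` on the polynomial ring. -/
noncomputable def weightMap (w : σ → ℕ) :
    MvPolynomial σ k →ₐ[k] Polynomial (MvPolynomial σ k) :=
  MvPolynomial.aeval fun i => Polynomial.C (MvPolynomial.X i) * Polynomial.X ^ w i

theorem weightMap_monomial (w : σ → ℕ) (m : σ →₀ ℕ) (a : k) :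
    weightMap w (MvPolynomial.monomial m a) =
      Polynomial.C (MvPolynomial.monomial m a) * Polynomial.X ^ Finsupp.weight w m := by
  rw [weightMap, MvPolynomial.aeval_monomial, MvPolynomial.monomial_eq, Finsupp.weight_apply,
    Finsupp.prod, Finsupp.prod, Finsupp.sum, map_mul, map_prod, ← Finset.prod_pow_eq_pow_sum,
    mul_assoc, ← Finset.prod_mul_distrib]
  congr 1
  refine Finset.prod_congr rfl fun i _ => ?_
  rw [mul_pow, map_pow, ← pow_mul, smul_eq_mul, mul_comm (w i)]

/-- The coaction turns weighted components into coefficients in a new variable, which makes the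
leading-coefficient criterion applicable to gradings. -/
theorem coeff_weightMap (w : σ → ℕ) (f : MvPolynomial σ k) (d : ℕ) :
    (weightMap w f).coeff d = MvPolynomial.weightedHomogeneousComponent w d f := by
  classical
  induction f using MvPolynomial.induction_on' with
  | monomial m b =>
    rw [weightMap_monomial, Polynomial.coeff_C_mul_X_pow]
    ext n
    rw [MvPolynomial.coeff_weightedHomogeneousComponent]
    by_cases hmn : m = n
    · subst hmn
      simp only [eq_comm (a := d)]
      split_ifs <;> simp
    · split_ifs <;> simp [MvPolynomial.coeff_monomial, hmn]
  | add f g hf hg => rw [map_add, map_add, Polynomial.coeff_add, hf, hg]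

theorem weightMap_of_isWeightedHomogeneous {w : σ → ℕ} {f : MvPolynomial σ k} {d : ℕ}
    (hf : MvPolynomial.IsWeightedHomogeneous w f d) :
    weightMap w f = Polynomial.C f * Polynomial.X ^ d := by
  classical
  ext1 n
  rw [coeff_weightMap, Polynomial.coeff_C_mul_X_pow]
  split_ifs with h
  · subst h
    exact hf.weightedHomogeneousComponent_same
  · exact hf.weightedHomogeneousComponent_ne n h

theorem isWeightedHomogeneous_component {w w' : σ → ℕ} {f : MvPolynomial σ k} {d' : ℕ} (d : ℕ)
    (hf : MvPolynomial.IsWeightedHomogeneous w' f d') :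
    MvPolynomial.IsWeightedHomogeneous w' (MvPolynomial.weightedHomogeneousComponent w d f) d' := by
  classical
  intro m hm
  apply hf
  intro h
  rw [MvPolynomial.coeff_weightedHomogeneousComponent, h, ite_self] at hm
  exact hm rfl

theorem natDegree_weightMap_le {w : σ → ℕ} {f : MvPolynomial σ k} {d : ℕ}
    (hf : ∀ e, d < e → MvPolynomial.weightedHomogeneousComponent w e f = 0) :
    (weightMap w f).natDegree ≤ d := by
  rw [Polynomial.natDegree_le_iff_coeff_eq_zero]
  intro e he
  rw [coeff_weightMap, hf e he]

/-- The diagonal substitution `X i ↦ t i * X i`. -/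
noncomputable def scale (t : σ → k) : MvPolynomial σ k →ₐ[k] MvPolynomial σ k :=
  MvPolynomial.aeval fun i => t i • MvPolynomial.X i

@[simp] theorem scale_X (t : σ → k) (i : σ) :
    scale t (MvPolynomial.X i) = t i • MvPolynomial.X i := by
  simp [scale]

theorem scale_monomial (t : σ → k) (m : σ →₀ ℕ) (a : k) :
    scale t (MvPolynomial.monomial m a) =
      (m.prod fun i n => t i ^ n) • MvPolynomial.monomial m a := by
  rw [scale, MvPolynomial.aeval_monomial, MvPolynomial.monomial_eq]
  simp only [Finsupp.prod, MvPolynomial.smul_eq_C_mul, Finset.prod_mul_distrib,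
    MvPolynomial.algebraMap_eq, map_prod, mul_pow, map_pow]
  ring

theorem scale_eq_smul {t : σ → k} {f : MvPolynomial σ k} {c : k}
    (h : ∀ m, MvPolynomial.coeff m f ≠ 0 → (m.prod fun i n => t i ^ n) = c) :
    scale t f = c • f := by
  conv_lhs => rw [f.as_sum]
  conv_rhs => rw [f.as_sum]
  rw [map_sum, Finset.smul_sum]
  refine Finset.sum_congr rfl fun m hm => ?_
  rw [scale_monomial, h m (MvPolynomial.mem_support_iff.1 hm)]

theorem scale_of_isWeightedHomogeneous {w : σ → ℕ} {f : MvPolynomial σ k} {d : ℕ}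
    (hf : MvPolynomial.IsWeightedHomogeneous w f d) (c : k) :
    scale (fun i => c ^ w i) f = c ^ d • f := by
  refine scale_eq_smul fun m hm => ?_
  rw [← hf hm, Finsupp.weight_apply, Finsupp.sum, Finsupp.prod, ← Finset.prod_pow_eq_pow_sum]
  refine Finset.prod_congr rfl fun i _ => ?_
  rw [← pow_mul, smul_eq_mul, mul_comm]

theorem scale_of_forall_isWeightedHomogeneous {J : Type*} [Fintype J] {w : J → σ → ℕ}
    {f : MvPolynomial σ k} {d : J → ℕ}
    (hf : ∀ j, MvPolynomial.IsWeightedHomogeneous (w j) f (d j)) (c : J → k) :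
    scale (fun i => ∏ j, c j ^ w j i) f = (∏ j, c j ^ d j) • f := by
  refine scale_eq_smul fun m hm => ?_
  simp only [Finsupp.prod, ← Finset.prod_pow]
  rw [Finset.prod_comm]
  refine Finset.prod_congr rfl fun j _ => ?_
  rw [← hf j hm, Finsupp.weight_apply, Finsupp.sum, ← Finset.prod_pow_eq_pow_sum]
  refine Finset.prod_congr rfl fun i _ => ?_
  rw [← pow_mul, smul_eq_mul, mul_comm]

end Weight

/-! ### Degeneration to top components -/

section Initial

variable {k σ : Type u} [Field k]

theorem trdeg_adjoin_initial_le (w : σ → ℕ) {s s' : Set (MvPolynomial σ k)}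
    (h : ∀ x ∈ s', ∃ y ∈ s, ∃ d, (weightMap w y).natDegree ≤ d ∧
      MvPolynomial.weightedHomogeneousComponent w d y = x) :
    Algebra.trdeg k (Algebra.adjoin k s') ≤ Algebra.trdeg k (Algebra.adjoin k s) := by
  refine trdeg_adjoin_le_of_forall _ _ fun t hts ht => ?_
  choose! y hy d hd hx using h
  have h1 : AlgebraicIndependent k fun i : t => weightMap w (y i) := by
    refine algebraicIndependent_of_coeff _ (fun i : t => d i) (fun i => hd _ (hts i.2)) ?_
    convert ht using 2 with i
    rw [coeff_weightMap, hx _ (hts i.2)]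
  have h2 : AlgebraicIndependent k fun i : t => y i := AlgebraicIndependent.of_comp (weightMap w) h1
  exact mk_le_trdeg_of_forall_mem _ h2 fun i => Algebra.subset_adjoin (hy _ (hts i.2))

end Initial

/-! ### Dimension of the image of a morphism -/

section CoordinateRing

variable {V W σ : Type*} [AddCommGroup V] [Module ℂ V] [AddCommGroup W] [Module ℂ W]

theorem linear_mem_coordRing (l : Module.Dual ℂ V) : (l : V → ℂ) ∈ coordRing V :=
  Algebra.subset_adjoin ⟨l, rfl⟩

/-- Evaluation of polynomials in the coordinates of a basis. -/
noncomputable def evalBasis (b : Module.Basis σ ℂ V) : MvPolynomial σ ℂ →ₐ[ℂ] (V → ℂ) :=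
  MvPolynomial.aeval fun i v => b.repr v i

theorem evalBasis_apply (b : Module.Basis σ ℂ V) (f : MvPolynomial σ ℂ) (v : V) :
    evalBasis b f v = MvPolynomial.eval (b.repr v) f := by
  induction f using MvPolynomial.induction_on with
  | C a => simp [evalBasis]
  | add f g hf hg => simp [hf, hg]
  | mul_X f i hf => simp [hf]; simp [evalBasis]

theorem evalBasis_injective [Finite σ] (b : Module.Basis σ ℂ V) :
    Function.Injective (evalBasis b) := by
  intro f g h
  apply MvPolynomial.funext
  intro x
  have := congrFun h (b.equivFun.symm x)
  rw [evalBasis_apply, evalBasis_apply] at this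
  have hx : ⇑(b.repr (b.equivFun.symm x)) = x := b.equivFun.apply_symm_apply x
  rwa [hx] at this

theorem range_evalBasis [Finite σ] (b : Module.Basis σ ℂ V) :
    (evalBasis b).range = coordRing V := by
  have := Fintype.ofFinite σ
  apply le_antisymm
  · rw [evalBasis, ← Algebra.adjoin_range_eq_range_aeval]
    refine Algebra.adjoin_le ?_
    rintro _ ⟨i, rfl⟩
    exact linear_mem_coordRing (b.coord i)
  · refine Algebra.adjoin_le ?_
    rintro _ ⟨l, rfl⟩
    refine ⟨∑ i, l (b i) • MvPolynomial.X i, ?_⟩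
    ext v
    change evalBasis b _ v = _
    have h : l v = ∑ i, b.repr v i * l (b i) := by
      conv_lhs => rw [← b.sum_repr v]
      simp only [map_sum, map_smul, smul_eq_mul]
    refine Eq.trans ?_ h.symm
    rw [evalBasis_apply]
    simp [MvPolynomial.smul_eval, mul_comm]

/-- The polynomials in the coordinates of `b` which are pulled back from `W` along `φ`. -/
noncomputable def pullback (b : Module.Basis σ ℂ V) (φ : V → W) :
    Subalgebra ℂ (MvPolynomial σ ℂ) :=
  Algebra.adjoin ℂ {f | ∃ l : Module.Dual ℂ W, ∀ v, evalBasis b f v = l (φ v)}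

theorem vanishingIdeal_zariskiClosure (S : Set V) :
    vanishingIdeal (zariskiClosure S) = vanishingIdeal S := by
  ext f
  exact ⟨fun hf v hv => hf v fun g hg => hg v hv, fun hf v hv => hv f hf⟩

/-- Precomposition with a map, as a homomorphism of algebras of functions. -/
def precomp (φ : V → W) : (W → ℂ) →ₐ[ℂ] (V → ℂ) where
  toFun f v := f (φ v)
  map_one' := rfl
  map_mul' _ _ := rfl
  map_zero' := rfl
  map_add' _ _ := rfl
  commutes' _ := rfl

theorem map_precomp_coordRing [Finite σ] (b : Module.Basis σ ℂ V) {φ : V → W} (hφ : IsMorphism φ) :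
    (coordRing W).map (precomp φ) = (pullback b φ).map (evalBasis b) := by
  rw [coordRing, AlgHom.map_adjoin, pullback, AlgHom.map_adjoin]
  congr 1
  ext f
  constructor
  · rintro ⟨_, ⟨l, rfl⟩, rfl⟩
    have h := hφ l
    rw [← range_evalBasis b] at h
    obtain ⟨g, hg⟩ := h
    exact ⟨g, ⟨l, fun v => congrFun hg v⟩, hg⟩
  · rintro ⟨g, ⟨l, hl⟩, rfl⟩
    exact ⟨l, ⟨l, rfl⟩, (funext hl).symm⟩

theorem finiteType_coordRing [FiniteDimensional ℂ W] : Algebra.FiniteType ℂ (coordRing W) := by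
  rw [← range_evalBasis (Module.finBasis ℂ W)]
  exact Algebra.FiniteType.of_surjective (evalBasis (Module.finBasis ℂ W)).rangeRestrict
    (evalBasis (Module.finBasis ℂ W)).rangeRestrict_surjective

/-- The regular functions on the closure of the image are the coordinate ring of `W` modulo the
kernel of precomposition with `φ`, that is, the algebra of pulled-back functions. -/
theorem exists_algebraicDim_eq_and_trdeg_pullback_eq [FiniteDimensional ℂ W] [Finite σ]
    (b : Module.Basis σ ℂ V) {φ : V → W} (hφ : IsMorphism φ) :
    ∃ n : ℕ, algebraicDim (zariskiClosure (Set.range φ)) = n ∧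
      Algebra.trdeg ℂ (pullback b φ) = n := by
  let Φ : coordRing W →ₐ[ℂ] (V → ℂ) := (precomp φ).comp (coordRing W).val
  have hrange : Φ.range = (pullback b φ).map (evalBasis b) := by
    rw [← map_precomp_coordRing b hφ]
    ext f
    constructor
    · rintro ⟨x, rfl⟩
      exact ⟨x, x.2, rfl⟩
    · rintro ⟨x, hx, rfl⟩
      exact ⟨⟨x, hx⟩, rfl⟩
  have hker : vanishingIdeal (zariskiClosure (Set.range φ)) = RingHom.ker Φ := by
    rw [vanishingIdeal_zariskiClosure]
    ext f
    constructor
    · intro hf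
      exact funext fun v => hf (φ v) ⟨v, rfl⟩
    · rintro hf _ ⟨v, rfl⟩
      exact congrFun hf v
  let e : pullback b φ ≃ₐ[ℂ] Φ.range :=
    ((pullback b φ).equivMapOfInjective (evalBasis b) (evalBasis_injective b)).trans
      (Subalgebra.equivOfEq _ _ hrange.symm)
  have : Algebra.FiniteType ℂ (coordRing W) := finiteType_coordRing
  have : Algebra.FiniteType ℂ (pullback b φ) :=
    Algebra.FiniteType.of_surjective (e.symm.toAlgHom.comp Φ.rangeRestrict)
      (e.symm.surjective.comp Φ.rangeRestrict_surjective)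
  obtain ⟨n, h1, h2⟩ := exists_ringKrullDim_eq_and_trdeg_eq ℂ (pullback b φ)
  refine ⟨n, ?_, h2⟩
  rw [← h1, algebraicDim, hker]
  exact (ringKrullDim_eq_of_ringEquiv (Ideal.quotientKerEquivRange Φ).toRingEquiv).trans
    (ringKrullDim_eq_of_ringEquiv e.toRingEquiv).symm

end CoordinateRing

/-! ### Covariants and stable spaces of polynomials -/

section Action

variable {G V σ : Type*} [Group G] [AddCommGroup V] [Module ℂ V]

/-- A group action on a polynomial ring is linear if it is induced by an action on the span
of the variables. -/
def IsLinearAction (τ : G →* (MvPolynomial σ ℂ →ₐ[ℂ] MvPolynomial σ ℂ)) : Prop :=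
  ∀ g i, τ g (MvPolynomial.X i) ∈ Submodule.span ℂ (Set.range (MvPolynomial.X (R := ℂ) (σ := σ)))

/-- The action on a subalgebra is well-defined and faithful. -/
structure IsFaithfulSubalgebra (τ : G →* (MvPolynomial σ ℂ →ₐ[ℂ] MvPolynomial σ ℂ))
    (S : Subalgebra ℂ (MvPolynomial σ ℂ)) : Prop where
  stable : ∀ g, ∀ s ∈ S, τ g s ∈ S
  faithful : ∀ g, (∀ s ∈ S, τ g s = s) → g = 1

/-- The algebra map `f ↦ f ∘ ρ g⁻¹` in coordinates. -/
noncomputable def substHom [Fintype σ] (b : Module.Basis σ ℂ V) (ρ : Representation ℂ G V)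
    (g : G) : MvPolynomial σ ℂ →ₐ[ℂ] MvPolynomial σ ℂ :=
  MvPolynomial.aeval fun i => ∑ j, b.repr (ρ g⁻¹ (b j)) i • MvPolynomial.X j

theorem evalBasis_substHom [Fintype σ] (b : Module.Basis σ ℂ V) (ρ : Representation ℂ G V) (g : G)
    (f : MvPolynomial σ ℂ) (v : V) :
    evalBasis b (substHom b ρ g f) v = evalBasis b f (ρ g⁻¹ v) := by
  rw [evalBasis_apply, evalBasis_apply]
  induction f using MvPolynomial.induction_on with
  | C a => simp [substHom]
  | add f g hf hg => simp [hf, hg]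
  | mul_X f i hf =>
    rw [map_mul, map_mul, map_mul, hf]
    congr 1
    have h : b.repr (ρ g⁻¹ v) i = ∑ j, b.repr v j * b.repr (ρ g⁻¹ (b j)) i := by
      conv_lhs => rw [← b.sum_repr v]
      simp only [map_sum, map_smul, Finsupp.coe_finsetSum, Finset.sum_apply, Finsupp.smul_apply,
        smul_eq_mul]
    rw [MvPolynomial.eval_X, h]
    simp [substHom, MvPolynomial.smul_eval, mul_comm]

/-- The action of a group on the polynomial ring in the coordinates of a representation. -/
noncomputable def basisAction [Fintype σ] (b : Module.Basis σ ℂ V) (ρ : Representation ℂ G V) :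
    G →* (MvPolynomial σ ℂ →ₐ[ℂ] MvPolynomial σ ℂ) where
  toFun := substHom b ρ
  map_one' := by
    refine AlgHom.ext fun f => evalBasis_injective b (funext fun v => ?_)
    simp [evalBasis_substHom]
  map_mul' g h := by
    refine AlgHom.ext fun f => evalBasis_injective b (funext fun v => ?_)
    simp [evalBasis_substHom, AlgHom.mul_apply]

theorem evalBasis_basisAction [Fintype σ] (b : Module.Basis σ ℂ V) (ρ : Representation ℂ G V)
    (g : G) (f : MvPolynomial σ ℂ) (v : V) :
    evalBasis b (basisAction b ρ g f) v = evalBasis b f (ρ g⁻¹ v) :=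
  evalBasis_substHom b ρ g f v

theorem isLinearAction_basisAction [Fintype σ] (b : Module.Basis σ ℂ V)
    (ρ : Representation ℂ G V) : IsLinearAction (basisAction b ρ) := by
  intro g i
  change substHom b ρ g _ ∈ _
  rw [substHom, MvPolynomial.aeval_X]
  exact Submodule.sum_mem _ fun j _ =>
    Submodule.smul_mem _ _ (Submodule.subset_span ⟨j, rfl⟩)

theorem isFaithfulSubalgebra_pullback [Fintype σ] {W : Type*} [AddCommGroup W] [Module ℂ W]
    (b : Module.Basis σ ℂ V) {ρ : Representation ℂ G V} {θ : Representation ℂ G W}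
    (φ : Covariant ρ θ) (hφ : φ.IsFaithful) :
    IsFaithfulSubalgebra (basisAction b ρ) (pullback b φ.toFun) where
  stable g s hs := by
    have h : (pullback b φ.toFun).map (basisAction b ρ g) ≤ pullback b φ.toFun := by
      rw [pullback, AlgHom.map_adjoin]
      refine Algebra.adjoin_mono ?_
      rintro _ ⟨f, ⟨l, hl⟩, rfl⟩
      refine ⟨l ∘ₗ θ g⁻¹, fun v => ?_⟩
      rw [evalBasis_basisAction, hl, φ.equivariant]
      rfl
    exact h ⟨s, hs, rfl⟩
  faithful g hg := by
    -- Functions are moved by `g⁻¹`, so it is `g⁻¹` that is shown to fix the image, by testing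
    -- against all linear functionals.
    rw [← inv_eq_one]
    refine hφ _ ?_
    rintro _ ⟨v, rfl⟩
    rw [← φ.equivariant, ← sub_eq_zero, ← Module.forall_dual_apply_eq_zero_iff ℂ]
    intro l
    have h := φ.isMorphism l
    rw [← range_evalBasis b] at h
    obtain ⟨f, hf⟩ := h
    have hf' : ∀ v, evalBasis b f v = l (φ.toFun v) := fun v => congrFun hf v
    rw [map_sub, ← hf', ← hf', ← evalBasis_basisAction, hg f (Algebra.subset_adjoin ⟨l, hf'⟩),
      sub_self]

theorem eval_add_of_mem_span {f : MvPolynomial σ ℂ}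
    (hf : f ∈ Submodule.span ℂ (Set.range (MvPolynomial.X (R := ℂ) (σ := σ)))) (v w : σ → ℂ) :
    MvPolynomial.eval (v + w) f = MvPolynomial.eval v f + MvPolynomial.eval w f := by
  induction hf using Submodule.span_induction with
  | mem x h => obtain ⟨i, rfl⟩ := h; simp
  | zero => simp
  | add x y _ _ hx hy => simp only [map_add, hx, hy]; ring
  | smul a x _ hx => simp only [MvPolynomial.smul_eval, hx]; ring

theorem eval_smul_of_mem_span {f : MvPolynomial σ ℂ}
    (hf : f ∈ Submodule.span ℂ (Set.range (MvPolynomial.X (R := ℂ) (σ := σ)))) (c : ℂ)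
    (v : σ → ℂ) : MvPolynomial.eval (c • v) f = c * MvPolynomial.eval v f := by
  induction hf using Submodule.span_induction with
  | mem x h => obtain ⟨i, rfl⟩ := h; simp
  | zero => simp
  | add x y _ _ hx hy => simp only [map_add, hx, hy]; ring
  | smul a x _ hx => simp only [MvPolynomial.smul_eval, hx]; ring

theorem eval_action (τ : G →* (MvPolynomial σ ℂ →ₐ[ℂ] MvPolynomial σ ℂ)) (g : G) (v : σ → ℂ)
    (f : MvPolynomial σ ℂ) :
    MvPolynomial.eval (fun i => MvPolynomial.eval v (τ g (MvPolynomial.X i))) f =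
      MvPolynomial.eval v (τ g f) := by
  induction f using MvPolynomial.induction_on with
  | C a => simp [← MvPolynomial.algebraMap_eq]
  | add f g hf hg => simp [hf, hg]
  | mul_X f i hf => simp [hf]

/-- The representation on the space of points of a linear action on a polynomial ring. -/
noncomputable def pointRep (τ : G →* (MvPolynomial σ ℂ →ₐ[ℂ] MvPolynomial σ ℂ))
    (hτ : IsLinearAction τ) : Representation ℂ G (σ → ℂ) where
  toFun g :=
    { toFun := fun v i => MvPolynomial.eval v (τ g⁻¹ (MvPolynomial.X i))
      map_add' := fun v w => funext fun i => eval_add_of_mem_span (hτ g⁻¹ i) v w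
      map_smul' := fun c v => funext fun i => eval_smul_of_mem_span (hτ g⁻¹ i) c v }
  map_one' := by ext; simp
  map_mul' g h := by
    refine LinearMap.ext fun v => funext fun i => ?_
    change MvPolynomial.eval v (τ (g * h)⁻¹ _) =
      MvPolynomial.eval (fun j => MvPolynomial.eval v (τ h⁻¹ (MvPolynomial.X j))) (τ g⁻¹ _)
    rw [eval_action, mul_inv_rev, map_mul, AlgHom.mul_apply]

theorem eval_pointRep (τ : G →* (MvPolynomial σ ℂ →ₐ[ℂ] MvPolynomial σ ℂ))
    (hτ : IsLinearAction τ) (g : G) (v : σ → ℂ) (f : MvPolynomial σ ℂ) :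
    MvPolynomial.eval (pointRep τ hτ g v) f = MvPolynomial.eval v (τ g⁻¹ f) :=
  eval_action τ g⁻¹ v f

/-- The representation on a stable space of polynomials. -/
noncomputable def stableRep (τ : G →* (MvPolynomial σ ℂ →ₐ[ℂ] MvPolynomial σ ℂ))
    (U : Submodule ℂ (MvPolynomial σ ℂ)) (hU : ∀ g, ∀ u ∈ U, τ g u ∈ U) :
    Representation ℂ G U where
  toFun g := (τ g).toLinearMap.restrict (hU g)
  map_one' := by ext; simp
  map_mul' g h := by
    refine LinearMap.ext fun u => Subtype.ext ?_
    change τ (g * h) u = τ g (τ h u)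
    rw [map_mul, AlgHom.mul_apply]

/-- The covariant given by evaluation of the elements of a stable space of polynomials. -/
noncomputable def evalCovariant [Finite σ] (τ : G →* (MvPolynomial σ ℂ →ₐ[ℂ] MvPolynomial σ ℂ))
    (hτ : IsLinearAction τ) (U : Submodule ℂ (MvPolynomial σ ℂ)) [FiniteDimensional ℂ U]
    (hU : ∀ g, ∀ u ∈ U, τ g u ∈ U) : Covariant (pointRep τ hτ) (stableRep τ U hU).dual where
  toFun v := (MvPolynomial.aeval v).toLinearMap ∘ₗ U.subtype
  isMorphism l := by
    obtain ⟨u, rfl⟩ := (Module.evalEquiv ℂ U).surjective l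
    rw [← range_evalBasis (Pi.basisFun ℂ σ)]
    refine ⟨u, funext fun v => ?_⟩
    change evalBasis _ _ v = _
    rw [evalBasis_apply]
    rfl
  equivariant g v := by
    ext u
    exact eval_pointRep τ hτ g v u

theorem isFaithful_evalCovariant [Finite σ]
    (τ : G →* (MvPolynomial σ ℂ →ₐ[ℂ] MvPolynomial σ ℂ))
    (hτ : IsLinearAction τ) (U : Submodule ℂ (MvPolynomial σ ℂ)) [FiniteDimensional ℂ U]
    (hU : ∀ g, ∀ u ∈ U, τ g u ∈ U) (hf : ∀ g, (∀ u ∈ U, τ g u = u) → g = 1) :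
    (evalCovariant τ hτ U hU).IsFaithful := by
  intro g hg
  rw [← inv_eq_one]
  refine hf _ fun u hu => ?_
  apply MvPolynomial.funext
  intro v
  exact LinearMap.congr_fun (hg _ ⟨v, rfl⟩) ⟨u, hu⟩

theorem pullback_evalCovariant_le [Finite σ]
    (τ : G →* (MvPolynomial σ ℂ →ₐ[ℂ] MvPolynomial σ ℂ))
    (hτ : IsLinearAction τ) (U : Submodule ℂ (MvPolynomial σ ℂ)) [FiniteDimensional ℂ U]
    (hU : ∀ g, ∀ u ∈ U, τ g u ∈ U) :
    pullback (Pi.basisFun ℂ σ) (evalCovariant τ hτ U hU).toFun ≤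
      Algebra.adjoin ℂ (U : Set (MvPolynomial σ ℂ)) := by
  refine Algebra.adjoin_mono ?_
  rintro f ⟨l, hl⟩
  obtain ⟨u, rfl⟩ := (Module.evalEquiv ℂ U).surjective l
  have : f = u := by
    apply MvPolynomial.funext
    intro v
    have h := hl v
    rw [evalBasis_apply] at h
    exact h
  exact this ▸ u.2

end Action

/-! ### Covariant dimension as a minimal transcendence degree -/

section Models

variable {G : Type*} [Group G] {σ : Type} [Finite σ]

/-- For each `g ≠ 1` pick an element of `S` moved by `g`. The orbits of these finitely many elements
span a stable faithful subspace `U` of `S`, and evaluation on `U` is the covariant. -/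
theorem exists_covariant_of_isFaithfulSubalgebra [Finite G]
    (τ : G →* (MvPolynomial σ ℂ →ₐ[ℂ] MvPolynomial σ ℂ)) (hτ : IsLinearAction τ)
    {S : Subalgebra ℂ (MvPolynomial σ ℂ)} (hS : IsFaithfulSubalgebra τ S) :
    ∃ d : ℕ, (∃ (V W : Type) (_ : AddCommGroup V) (_ : Module ℂ V) (_ : FiniteDimensional ℂ V)
      (_ : AddCommGroup W) (_ : Module ℂ W) (_ : FiniteDimensional ℂ W)
      (ρ : Representation ℂ G V) (σ : Representation ℂ G W) (φ : Covariant ρ σ),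
        φ.IsFaithful ∧ φ.dim = (d : WithBot ℕ∞)) ∧ (d : Cardinal) ≤ Algebra.trdeg ℂ S := by
  have hex : ∀ g : G, ∃ s ∈ S, g ≠ 1 → τ g s ≠ s := by
    intro g
    by_cases hg : g = 1
    · exact ⟨0, S.zero_mem, fun h => absurd hg h⟩
    · by_contra! h
      exact hg (hS.faithful g fun s hs => (h s hs).2)
  choose s hs hsg using hex
  let U : Submodule ℂ (MvPolynomial σ ℂ) :=
    Submodule.span ℂ (Set.range fun x : G × G => τ x.1 (s x.2))
  have : FiniteDimensional ℂ U := FiniteDimensional.span_of_finite ℂ (Set.finite_range _)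
  have hU : ∀ g, ∀ u ∈ U, τ g u ∈ U := by
    intro g u hu
    have h : U.map (τ g).toLinearMap ≤ U := by
      rw [Submodule.map_span]
      refine Submodule.span_mono ?_
      rintro _ ⟨_, ⟨x, rfl⟩, rfl⟩
      exact ⟨(g * x.1, x.2), by simp [AlgHom.mul_apply]⟩
    exact h ⟨u, hu, rfl⟩
  have hUf : ∀ g, (∀ u ∈ U, τ g u = u) → g = 1 := by
    intro g hg
    by_contra h1
    exact hsg g h1 (hg _ (Submodule.subset_span ⟨(1, g), by simp⟩))
  have hUS : Algebra.adjoin ℂ (U : Set (MvPolynomial σ ℂ)) ≤ S := by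
    refine Algebra.adjoin_le ?_
    have : U ≤ Subalgebra.toSubmodule S := Submodule.span_le.2 (by
      rintro _ ⟨x, rfl⟩
      exact hS.stable _ _ (hs _))
    exact this
  obtain ⟨n, h1, h2⟩ := exists_algebraicDim_eq_and_trdeg_pullback_eq (Pi.basisFun ℂ σ)
    (evalCovariant τ hτ U hU).isMorphism
  exact ⟨n, ⟨_, _, _, _, inferInstance, _, _, inferInstance, _, _, evalCovariant τ hτ U hU,
    isFaithful_evalCovariant τ hτ U hU hUf, h1⟩,
    h2 ▸ trdeg_mono ((pullback_evalCovariant_le τ hτ U hU).trans hUS)⟩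

theorem covdim_le_of_isFaithfulSubalgebra [Finite G]
    (τ : G →* (MvPolynomial σ ℂ →ₐ[ℂ] MvPolynomial σ ℂ)) (hτ : IsLinearAction τ)
    {S : Subalgebra ℂ (MvPolynomial σ ℂ)} (hS : IsFaithfulSubalgebra τ S) {d : ℕ}
    (hd : Algebra.trdeg ℂ S ≤ d) : covdim G ≤ d := by
  obtain ⟨n, h1, h2⟩ := exists_covariant_of_isFaithfulSubalgebra τ hτ hS
  exact (Nat.sInf_le h1).trans (by exact_mod_cast h2.trans hd)

/-- The action on polynomials in variables indexed by a group of the same size. -/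
noncomputable def regularAction {n : ℕ} (e : G ≃ Fin n) :
    G →* (MvPolynomial (Fin n) ℂ →ₐ[ℂ] MvPolynomial (Fin n) ℂ) where
  toFun g := MvPolynomial.rename fun i => e (g * e.symm i)
  map_one' := by ext; simp
  map_mul' g h := by
    refine MvPolynomial.algHom_ext fun i => ?_
    simp [AlgHom.mul_apply, mul_assoc]

/-- The regular representation shows that faithful covariants exist, so the infimum is attained. The
basis stays arbitrary so that it can later be adapted to central elements. -/
theorem exists_basis_model_trdeg_eq_covdim (G : Type*) [Group G] [Finite G] :
    ∃ (V : Type) (_ : AddCommGroup V) (_ : Module ℂ V) (_ : FiniteDimensional ℂ V)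
      (ρ : Representation ℂ G V), ∀ {σ : Type} [Fintype σ] (b : Module.Basis σ ℂ V),
        ∃ S, IsFaithfulSubalgebra (basisAction b ρ) S ∧ Algebra.trdeg ℂ S = covdim G := by
  obtain ⟨n, ⟨e⟩⟩ := Finite.exists_equiv_fin G
  have h : IsFaithfulSubalgebra (regularAction e) ⊤ := by
    refine ⟨fun _ _ _ => trivial, fun g hg => ?_⟩
    have := hg (MvPolynomial.X (e 1)) trivial
    simpa [regularAction, MvPolynomial.X_inj] using this
  obtain ⟨d, hd, -⟩ := exists_covariant_of_isFaithfulSubalgebra (regularAction e)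
    (fun g i => by
      simp only [regularAction, MonoidHom.coe_mk, OneHom.coe_mk, MvPolynomial.rename_X]
      exact Submodule.subset_span ⟨_, rfl⟩) h
  have hmem := Nat.sInf_mem (s := {d : ℕ | ∃ (V W : Type) (_ : AddCommGroup V) (_ : Module ℂ V)
    (_ : FiniteDimensional ℂ V) (_ : AddCommGroup W) (_ : Module ℂ W) (_ : FiniteDimensional ℂ W)
    (ρ : Representation ℂ G V) (σ : Representation ℂ G W) (φ : Covariant ρ σ),
      φ.IsFaithful ∧ φ.dim = (d : WithBot ℕ∞)}) ⟨d, hd⟩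
  obtain ⟨V, W, _, _, hV, _, _, hW, ρ, θ, φ, hφ, hdim⟩ := hmem
  refine ⟨V, _, _, hV, ρ, fun b => ⟨_, isFaithfulSubalgebra_pullback b φ hφ, ?_⟩⟩
  obtain ⟨m, h1, h2⟩ := exists_algebraicDim_eq_and_trdeg_pullback_eq b φ.isMorphism
  rw [h2]
  have : (m : WithBot ℕ∞) = (covdim G : ℕ) := h1.symm.trans hdim
  exact_mod_cast this

theorem exists_model_trdeg_eq_covdim (G : Type*) [Group G] [Finite G] :
    ∃ (n : ℕ) (τ : G →* (MvPolynomial (Fin n) ℂ →ₐ[ℂ] MvPolynomial (Fin n) ℂ))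
      (S : Subalgebra ℂ (MvPolynomial (Fin n) ℂ)), IsLinearAction τ ∧
        IsFaithfulSubalgebra τ S ∧ Algebra.trdeg ℂ S = covdim G := by
  obtain ⟨V, _, _, _, ρ, h⟩ := exists_basis_model_trdeg_eq_covdim G
  obtain ⟨S, h1, h2⟩ := h (Module.finBasis ℂ V)
  exact ⟨_, _, S, isLinearAction_basisAction _ ρ, h1, h2⟩

theorem covdim_le_of_injective {H : Type*} [Group H] [Finite H] [Finite G] (i : H →* G)
    (hi : Function.Injective i) : covdim H ≤ covdim G := by
  obtain ⟨n, τ, S, h1, h2, h3⟩ := exists_model_trdeg_eq_covdim G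
  refine covdim_le_of_isFaithfulSubalgebra (τ.comp i) (fun g => h1 (i g)) (S := S)
    ⟨fun g => h2.stable (i g), fun g hg => hi ?_⟩ h3.le
  rw [map_one]
  exact h2.faithful _ hg

theorem covdim_congr {H : Type*} [Group H] [Finite H] [Finite G] (e : H ≃* G) :
    covdim H = covdim G :=
  le_antisymm (covdim_le_of_injective e.toMonoidHom e.injective)
    (covdim_le_of_injective e.symm.toMonoidHom e.symm.injective)

end Models

/-! ### Irreducible representations inside faithful subalgebras -/

section Equivariant

variable {G σ : Type*} [Group G] {W : Type*} [AddCommGroup W] [Module ℂ W]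

/-- Equivariance of a linear map from a representation to a polynomial ring. -/
def IsEquivariant (τ : G →* (MvPolynomial σ ℂ →ₐ[ℂ] MvPolynomial σ ℂ))
    (ρ : Representation ℂ G W) (u : W →ₗ[ℂ] MvPolynomial σ ℂ) : Prop :=
  ∀ g w, u (ρ g w) = τ g (u w)

/-- Average `l (ρ g⁻¹ w) • τ g s` over `G`. If this vanished for all `s` in `S`, it would be at `w₀`
a linear relation between the maps `τ g` on `S`. These are distinct by faithfulness, so Dedekind's
theorem forbids it: the coefficient at `g = 1` is `l w₀ ≠ 0`. -/
theorem IsFaithfulSubalgebra.exists_isEquivariant [Finite G]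
    {τ : G →* (MvPolynomial σ ℂ →ₐ[ℂ] MvPolynomial σ ℂ)} {S : Subalgebra ℂ (MvPolynomial σ ℂ)}
    (hS : IsFaithfulSubalgebra τ S) [Nontrivial W] (ρ : Representation ℂ G W) :
    ∃ u : W →ₗ[ℂ] MvPolynomial σ ℂ, IsEquivariant τ ρ u ∧ u ≠ 0 ∧ ∀ w, u w ∈ S := by
  have := Fintype.ofFinite G
  obtain ⟨w₀, hw₀⟩ := exists_ne (0 : W)
  obtain ⟨l, hl⟩ : ∃ l : Module.Dual ℂ W, l w₀ ≠ 0 := by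
    by_contra! h
    exact hw₀ ((Module.forall_dual_apply_eq_zero_iff ℂ w₀).1 h)
  let u (s : MvPolynomial σ ℂ) : W →ₗ[ℂ] MvPolynomial σ ℂ :=
    ∑ g : G, (l ∘ₗ ρ g⁻¹).smulRight (τ g s)
  have hu (s) (w : W) : u s w = ∑ g : G, l (ρ g⁻¹ w) • τ g s := by simp [u]
  have heq (s) : IsEquivariant τ ρ (u s) := by
    intro h w
    rw [hu, hu, map_sum, ← Equiv.sum_comp (Equiv.mulLeft h)]
    refine Finset.sum_congr rfl fun g _ => ?_
    rw [map_smul, Equiv.coe_mulLeft, map_mul, AlgHom.mul_apply, ← Module.End.mul_apply,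
      ← map_mul, mul_inv_rev, inv_mul_cancel_right]
  have hmem (s) (hs : s ∈ S) (w) : u s w ∈ S := by
    rw [hu]
    exact S.sum_mem fun g _ => S.smul_mem (hS.stable g s hs) _
  suffices h : ∃ s ∈ S, u s ≠ 0 by
    obtain ⟨s, hs, h⟩ := h
    exact ⟨u s, heq s, h, hmem s hs⟩
  by_contra! h
  let χ (g : G) : S →* MvPolynomial σ ℂ := ((τ g).comp S.val : S →* MvPolynomial σ ℂ)
  have hχ : Function.Injective χ := by
    intro g g' hg
    rw [← inv_mul_eq_one]
    refine hS.faithful _ fun s hs => ?_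
    have h1 : τ g s = τ g' s := DFunLike.congr_fun hg ⟨s, hs⟩
    rw [map_mul, AlgHom.mul_apply, ← h1, ← AlgHom.mul_apply, ← map_mul, inv_mul_cancel, map_one,
      AlgHom.one_apply]
  have hind := (linearIndependent_monoidHom S (MvPolynomial σ ℂ)).comp χ hχ
  rw [Fintype.linearIndependent_iff] at hind
  have h1 := hind (fun g => MvPolynomial.C (l (ρ g⁻¹ w₀))) (by
    ext1 s
    have h2 := hu s.1 w₀
    rw [h _ s.2] at h2
    simpa [MvPolynomial.smul_eq_C_mul, χ] using h2.symm) 1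
  apply hl
  simpa using h1

theorem IsEquivariant.injective {τ : G →* (MvPolynomial σ ℂ →ₐ[ℂ] MvPolynomial σ ℂ)}
    {ρ : Representation ℂ G W} {u : W →ₗ[ℂ] MvPolynomial σ ℂ} (hu : IsEquivariant τ ρ u)
    (hρ : ρ.IsIrreducible) (h0 : u ≠ 0) : Function.Injective u := by
  let K : Subrepresentation ρ := ⟨LinearMap.ker u, fun g v hv => by
    rw [LinearMap.mem_ker] at hv ⊢
    rw [hu, hv, map_zero]⟩
  rw [← LinearMap.ker_eq_bot]
  rcases hρ.eq_bot_or_eq_top K with h | h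
  · exact congrArg Subrepresentation.toSubmodule h
  · exact absurd (LinearMap.ker_eq_top.1 (congrArg Subrepresentation.toSubmodule h)) h0

theorem nontrivial_of_isIrreducible {ρ : Representation ℂ G W}
    (hρ : ρ.IsIrreducible) : Nontrivial W := by
  by_contra h
  rw [not_nontrivial_iff_subsingleton] at h
  obtain ⟨a, b, hab⟩ := hρ.exists_pair_ne
  exact hab (Subrepresentation.toSubmodule_injective (Subsingleton.elim _ _))

/-- A family of irreducible representations on which a group acts jointly faithfully. -/
structure IsFaithfulFamily {J : Type*} {n : J → ℕ}
    (ρ : ∀ j, Representation ℂ G (Fin (n j) → ℂ)) : Prop where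
  irreducible : ∀ j, (ρ j).IsIrreducible
  faithful : ∀ g, (∀ j, ρ j g = 1) → g = 1

/-- The algebra generated by the images of a family of linear maps. -/
noncomputable def imageAlgebra {J : Type*} {n : J → ℕ}
    (u : ∀ j, (Fin (n j) → ℂ) →ₗ[ℂ] MvPolynomial σ ℂ) : Subalgebra ℂ (MvPolynomial σ ℂ) :=
  Algebra.adjoin ℂ (⋃ j, Set.range (u j))

theorem mem_imageAlgebra {J : Type*} {n : J → ℕ}
    (u : ∀ j, (Fin (n j) → ℂ) →ₗ[ℂ] MvPolynomial σ ℂ) (j : J) (w : Fin (n j) → ℂ) :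
    u j w ∈ imageAlgebra u :=
  Algebra.subset_adjoin (Set.mem_iUnion.2 ⟨j, w, rfl⟩)

theorem imageAlgebra_le {J : Type*} {n : J → ℕ}
    {u : ∀ j, (Fin (n j) → ℂ) →ₗ[ℂ] MvPolynomial σ ℂ} {S : Subalgebra ℂ (MvPolynomial σ ℂ)}
    (h : ∀ j w, u j w ∈ S) : imageAlgebra u ≤ S := by
  refine Algebra.adjoin_le (Set.iUnion_subset fun j => ?_)
  rintro _ ⟨w, rfl⟩
  exact h j w

theorem imageAlgebra_stable {J : Type*} {n : J → ℕ}
    {ρ : ∀ j, Representation ℂ G (Fin (n j) → ℂ)}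
    {τ : G →* (MvPolynomial σ ℂ →ₐ[ℂ] MvPolynomial σ ℂ)}
    {u : ∀ j, (Fin (n j) → ℂ) →ₗ[ℂ] MvPolynomial σ ℂ} (hu : ∀ j, IsEquivariant τ (ρ j) (u j))
    (g : G) : ∀ s ∈ imageAlgebra u, τ g s ∈ imageAlgebra u := by
  have h : imageAlgebra u ≤ (imageAlgebra u).comap (τ g) := imageAlgebra_le fun j w => by
    rw [Subalgebra.mem_comap, ← hu]
    exact mem_imageAlgebra u j _
  exact h

/-- By irreducibility each nonzero `u j` is injective, so an element fixing all the images acts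
trivially in every `ρ j`. -/
theorem IsFaithfulFamily.isFaithfulSubalgebra {J : Type*} {n : J → ℕ}
    {ρ : ∀ j, Representation ℂ G (Fin (n j) → ℂ)} (hρ : IsFaithfulFamily ρ)
    {τ : G →* (MvPolynomial σ ℂ →ₐ[ℂ] MvPolynomial σ ℂ)}
    {u : ∀ j, (Fin (n j) → ℂ) →ₗ[ℂ] MvPolynomial σ ℂ} (hu : ∀ j, IsEquivariant τ (ρ j) (u j))
    (h0 : ∀ j, u j ≠ 0) : IsFaithfulSubalgebra τ (imageAlgebra u) where
  stable := imageAlgebra_stable hu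
  faithful g hg := by
    refine hρ.faithful g fun j => LinearMap.ext fun w => ?_
    apply (hu j).injective (hρ.irreducible j) (h0 j)
    rw [hu, hg _ (mem_imageAlgebra u j w), Module.End.one_apply]

theorem IsFaithfulFamily.exists_isEquivariant [Finite G] {J : Type*} {n : J → ℕ}
    {ρ : ∀ j, Representation ℂ G (Fin (n j) → ℂ)} (hρ : IsFaithfulFamily ρ)
    {τ : G →* (MvPolynomial σ ℂ →ₐ[ℂ] MvPolynomial σ ℂ)} {S : Subalgebra ℂ (MvPolynomial σ ℂ)}
    (hS : IsFaithfulSubalgebra τ S) :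
    ∃ u : ∀ j, (Fin (n j) → ℂ) →ₗ[ℂ] MvPolynomial σ ℂ, (∀ j, IsEquivariant τ (ρ j) (u j)) ∧
      (∀ j, u j ≠ 0) ∧ imageAlgebra u ≤ S := by
  have h (j) : ∃ u : (Fin (n j) → ℂ) →ₗ[ℂ] MvPolynomial σ ℂ, IsEquivariant τ (ρ j) u ∧ u ≠ 0 ∧
      ∀ w, u w ∈ S := by
    have := nontrivial_of_isIrreducible (hρ.irreducible j)
    exact hS.exists_isEquivariant (ρ j)
  choose u h1 h2 h3 using h
  exact ⟨u, h1, h2, imageAlgebra_le h3⟩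

end Equivariant

/-! ### Making equivariant maps homogeneous -/

section Homogenization

variable {G : Type*} {σ : Type} [Group G]

/-- A group action on a polynomial ring which preserves the grading by a weight. -/
def PreservesWeight (τ : G →* (MvPolynomial σ ℂ →ₐ[ℂ] MvPolynomial σ ℂ)) (w : σ → ℕ) : Prop :=
  ∀ g i, MvPolynomial.IsWeightedHomogeneous w (τ g (MvPolynomial.X i)) (w i)

theorem PreservesWeight.component_apply {τ : G →* (MvPolynomial σ ℂ →ₐ[ℂ] MvPolynomial σ ℂ)}
    {w : σ → ℕ} (hw : PreservesWeight τ w) (g : G) (d : ℕ) (f : MvPolynomial σ ℂ) :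
    MvPolynomial.weightedHomogeneousComponent w d (τ g f) =
      τ g (MvPolynomial.weightedHomogeneousComponent w d f) := by
  have h : (weightMap w).comp (τ g) = (Polynomial.mapAlgHom (τ g)).comp (weightMap w) := by
    refine MvPolynomial.algHom_ext fun i => ?_
    rw [AlgHom.comp_apply, AlgHom.comp_apply, weightMap_of_isWeightedHomogeneous (hw g i),
      weightMap_of_isWeightedHomogeneous (MvPolynomial.isWeightedHomogeneous_X ℂ w i)]
    simp
  rw [← coeff_weightMap, ← coeff_weightMap]
  have h2 := congrArg (fun p => p.coeff d) (DFunLike.congr_fun h f)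
  simpa [Polynomial.coeff_map] using h2

/-- The degree is chosen for `u` as a whole and not value by value, so that the component is again a
linear map, and equivariant when `u` is. -/
theorem exists_top_component {W : Type*} [AddCommGroup W] [Module ℂ W] [FiniteDimensional ℂ W]
    (w : σ → ℕ) {u : W →ₗ[ℂ] MvPolynomial σ ℂ} (hu : u ≠ 0) :
    ∃ d, MvPolynomial.weightedHomogeneousComponent w d ∘ₗ u ≠ 0 ∧
      ∀ e, d < e → MvPolynomial.weightedHomogeneousComponent w e ∘ₗ u = 0 := by
  classical
  have hbound : ∃ N, ∀ e, N ≤ e → MvPolynomial.weightedHomogeneousComponent w e ∘ₗ u = 0 := by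
    let b := Module.finBasis ℂ W
    refine ⟨(Finset.univ.sup fun i => (weightMap w (u (b i))).natDegree) + 1, fun e he => ?_⟩
    refine b.ext fun i => ?_
    rw [LinearMap.comp_apply, ← coeff_weightMap, LinearMap.zero_apply]
    refine Polynomial.coeff_eq_zero_of_natDegree_lt ?_
    exact (Finset.le_sup (f := fun i => (weightMap w (u (b i))).natDegree)
      (Finset.mem_univ i)).trans_lt he
  obtain ⟨N, hN, hmin⟩ : ∃ N, (∀ e, N ≤ e →
      MvPolynomial.weightedHomogeneousComponent w e ∘ₗ u = 0) ∧ ∀ M < N, ¬ ∀ e, M ≤ e →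
      MvPolynomial.weightedHomogeneousComponent w e ∘ₗ u = 0 :=
    ⟨Nat.find hbound, Nat.find_spec hbound, fun M hM => Nat.find_min hbound hM⟩
  cases N with
  | zero =>
    refine absurd (LinearMap.ext fun x => ?_) hu
    ext m
    have h := congrArg (MvPolynomial.coeff m)
      (LinearMap.congr_fun (hN (Finsupp.weight w m) (Nat.zero_le _)) x)
    rwa [LinearMap.comp_apply, MvPolynomial.coeff_weightedHomogeneousComponent, if_pos rfl] at h
  | succ d =>
    refine ⟨d, fun h => hmin d d.lt_succ_self fun e he => ?_, fun e he => hN e he⟩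
    rcases he.eq_or_lt with rfl | he
    · exact h
    · exact hN e he

/-- The last clause, that homogeneity for other weights survives, allows several gradings to be
treated one after another. -/
theorem exists_isWeightedHomogeneous {J : Type*} {n : J → ℕ}
    {ρ : ∀ j, Representation ℂ G (Fin (n j) → ℂ)}
    {τ : G →* (MvPolynomial σ ℂ →ₐ[ℂ] MvPolynomial σ ℂ)} {w : σ → ℕ} (hw : PreservesWeight τ w)
    {u : ∀ j, (Fin (n j) → ℂ) →ₗ[ℂ] MvPolynomial σ ℂ} (hu : ∀ j, IsEquivariant τ (ρ j) (u j))
    (h0 : ∀ j, u j ≠ 0) :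
    ∃ u' : ∀ j, (Fin (n j) → ℂ) →ₗ[ℂ] MvPolynomial σ ℂ, (∀ j, IsEquivariant τ (ρ j) (u' j)) ∧
      (∀ j, u' j ≠ 0) ∧ Algebra.trdeg ℂ (imageAlgebra u') ≤ Algebra.trdeg ℂ (imageAlgebra u) ∧
      (∀ j, ∃ d, ∀ x, MvPolynomial.IsWeightedHomogeneous w (u' j x) d) ∧
      ∀ (w' : σ → ℕ) j d, (∀ x, MvPolynomial.IsWeightedHomogeneous w' (u j x) d) →
        ∀ x, MvPolynomial.IsWeightedHomogeneous w' (u' j x) d := by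
  choose d hd hmax using fun j => exists_top_component w (h0 j)
  refine ⟨fun j => MvPolynomial.weightedHomogeneousComponent w (d j) ∘ₗ u j, fun j g x => ?_, hd,
    ?_, fun j => ⟨d j, fun x => ?_⟩, fun w' j d' h x => ?_⟩
  · rw [LinearMap.comp_apply, hu, hw.component_apply, LinearMap.comp_apply]
  · refine trdeg_adjoin_initial_le w ?_
    intro x hx
    obtain ⟨j, y, rfl⟩ := Set.mem_iUnion.1 hx
    exact ⟨u j y, Set.mem_iUnion.2 ⟨j, y, rfl⟩, d j,
      natDegree_weightMap_le fun e he => LinearMap.congr_fun (hmax j e he) y, rfl⟩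
  · exact MvPolynomial.weightedHomogeneousComponent_isWeightedHomogeneous _ _
  · exact isWeightedHomogeneous_component _ (h x)

theorem exists_forall_isWeightedHomogeneous {J : Type*} {n : J → ℕ}
    {ρ : ∀ j, Representation ℂ G (Fin (n j) → ℂ)}
    {τ : G →* (MvPolynomial σ ℂ →ₐ[ℂ] MvPolynomial σ ℂ)} {I : Type*} [Finite I] {w : I → σ → ℕ}
    (hw : ∀ i, PreservesWeight τ (w i))
    {u : ∀ j, (Fin (n j) → ℂ) →ₗ[ℂ] MvPolynomial σ ℂ} (hu : ∀ j, IsEquivariant τ (ρ j) (u j))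
    (h0 : ∀ j, u j ≠ 0) :
    ∃ u' : ∀ j, (Fin (n j) → ℂ) →ₗ[ℂ] MvPolynomial σ ℂ, (∀ j, IsEquivariant τ (ρ j) (u' j)) ∧
      (∀ j, u' j ≠ 0) ∧ Algebra.trdeg ℂ (imageAlgebra u') ≤ Algebra.trdeg ℂ (imageAlgebra u) ∧
      ∀ i j, ∃ d, ∀ x, MvPolynomial.IsWeightedHomogeneous (w i) (u' j x) d := by
  classical
  have := Fintype.ofFinite I
  suffices h : ∀ s : Finset I, ∃ u' : ∀ j, (Fin (n j) → ℂ) →ₗ[ℂ] MvPolynomial σ ℂ,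
      (∀ j, IsEquivariant τ (ρ j) (u' j)) ∧ (∀ j, u' j ≠ 0) ∧
      Algebra.trdeg ℂ (imageAlgebra u') ≤ Algebra.trdeg ℂ (imageAlgebra u) ∧
      ∀ i ∈ s, ∀ j, ∃ d, ∀ x, MvPolynomial.IsWeightedHomogeneous (w i) (u' j x) d by
    obtain ⟨u', h1, h2, h3, h4⟩ := h Finset.univ
    exact ⟨u', h1, h2, h3, fun i => h4 i (Finset.mem_univ i)⟩
  intro s
  induction s using Finset.induction_on with
  | empty => exact ⟨u, hu, h0, le_rfl, by simp⟩
  | insert a s _ ih =>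
    obtain ⟨u', h1, h2, h3, h4⟩ := ih
    obtain ⟨u'', g1, g2, g3, g4, g5⟩ := exists_isWeightedHomogeneous (hw a) h1 h2
    refine ⟨u'', g1, g2, g3.trans h3, fun i hi j => ?_⟩
    rcases Finset.mem_insert.1 hi with rfl | hi
    · exact g4 j
    · obtain ⟨d, hd⟩ := h4 i hi j
      exact ⟨d, g5 (w i) j d hd⟩

end Homogenization

/-! ### Twisting by characters of a cyclic group -/

section Twist

variable {G C W : Type*} [Group G] [Group C] [AddCommGroup W] [Module ℂ W]

theorem isIrreducible_of_stable {ρ : Representation ℂ G W} (hρ : ρ.IsIrreducible)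
    {θ : Representation ℂ C W}
    (h : ∀ K : Submodule ℂ W, (∀ c, ∀ v ∈ K, θ c v ∈ K) → ∀ g, ∀ v ∈ K, ρ g v ∈ K) :
    θ.IsIrreducible := by
  have := nontrivial_of_isIrreducible hρ
  have hnt : Nontrivial (Subrepresentation θ) :=
    ⟨⊥, ⊤, fun h => bot_ne_top (congrArg Subrepresentation.toSubmodule h)⟩
  refine { eq_bot_or_eq_top := fun K => ?_ }
  let K' : Subrepresentation ρ :=
    ⟨K.toSubmodule, fun g v hv => h K.toSubmodule (fun c v hv => K.apply_mem_toSubmodule c hv) g v hv⟩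
  rcases hρ.eq_bot_or_eq_top K' with h | h
  · exact Or.inl (Subrepresentation.toSubmodule_injective
      (congrArg Subrepresentation.toSubmodule h :))
  · exact Or.inr (Subrepresentation.toSubmodule_injective
      (congrArg Subrepresentation.toSubmodule h :))

/-- The external tensor product of a representation with a linear character. -/
def twist (ρ : Representation ℂ G W) (χ : C →* ℂ) : Representation ℂ (G × C) W where
  toFun x := χ x.2 • ρ x.1
  map_one' := by simp
  map_mul' x y := by
    refine LinearMap.ext fun v => ?_
    change χ (x.2 * y.2) • ρ (x.1 * y.1) v = χ x.2 • ρ x.1 (χ y.2 • ρ y.1 v)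
    rw [map_mul χ, map_mul ρ, map_smul, mul_smul]
    rfl

@[simp] theorem twist_apply (ρ : Representation ℂ G W) (χ : C →* ℂ) (x : G × C) :
    twist ρ χ x = χ x.2 • ρ x.1 := rfl

theorem isIrreducible_twist {ρ : Representation ℂ G W} (hρ : ρ.IsIrreducible) (χ : C →* ℂ) :
    (twist ρ χ).IsIrreducible :=
  isIrreducible_of_stable hρ fun K hK g v hv => by simpa using hK (g, 1) v hv

theorem isPrimitiveRoot_of_injective {p : ℕ} [NeZero p] {χ : Multiplicative (ZMod p) →* ℂ}
    (hχ : Function.Injective χ) : IsPrimitiveRoot (χ (Multiplicative.ofAdd 1)) p := by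
  constructor
  · rw [← map_pow, ← ofAdd_nsmul]
    simp
  · intro l hl
    rw [← map_pow, ← map_one χ, hχ.eq_iff, ← ofAdd_nsmul, ofAdd_eq_one] at hl
    simpa [ZMod.natCast_eq_zero_iff] using hl

theorem pow_eq_one_multiplicative_zmod {p : ℕ} (c : Multiplicative (ZMod p)) : c ^ p = 1 := by
  apply Multiplicative.toAdd.injective
  simp

theorem mem_center_of_scalar {J : Type*} {n : J → ℕ}
    {ρ : ∀ j, Representation ℂ G (Fin (n j) → ℂ)} (hρ : IsFaithfulFamily ρ) {g : G} {a : J → ℂ}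
    (hg : ∀ j, ρ j g = a j • 1) : g ∈ Subgroup.center G := by
  rw [Subgroup.mem_center_iff]
  intro h
  rw [← mul_inv_eq_one]
  refine hρ.faithful _ fun j => ?_
  have : ρ j (h * g) = ρ j (g * h) := by
    rw [map_mul, map_mul, hg]; simp
  rw [map_mul, this, ← map_mul, mul_inv_cancel, map_one]

theorem eq_one_of_coprime_card_center [Finite G] {p : ℕ}
    (hcop : Nat.Coprime p (Nat.card (Subgroup.center G))) {g : G} (hg : g ∈ Subgroup.center G)
    (hgp : g ^ p = 1) : g = 1 := by
  have h1 : orderOf g ∣ p := orderOf_dvd_of_pow_eq_one hgp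
  have h2 : orderOf g ∣ Nat.card (Subgroup.center G) := by
    rw [← Subgroup.orderOf_mk g hg]
    exact orderOf_dvd_natCard _
  exact orderOf_eq_one_iff.1 (Nat.eq_one_of_dvd_coprimes hcop h1 h2)

/-- If `(g, c)` acts trivially, every `ρ j g` is a scalar with `p`-th power one. So `g` is central
with `g ^ p = 1`, hence trivial by coprimality. Then `c ^ d j = 1` for all `j`, and an exponent
prime to `p` gives `c = 1`. -/
theorem IsFaithfulFamily.twist [Finite G] {J : Type*} {n : J → ℕ}
    {ρ : ∀ j, Representation ℂ G (Fin (n j) → ℂ)} (hρ : IsFaithfulFamily ρ) {p : ℕ}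
    (hp : p.Prime) (hcop : Nat.Coprime p (Nat.card (Subgroup.center G)))
    {χ : Multiplicative (ZMod p) →* ℂ} (hχ : Function.Injective χ) {d : J → ℕ}
    (hd : ∃ j, ¬ p ∣ d j) : IsFaithfulFamily fun j => twist (ρ j) (χ ^ d j) where
  irreducible j := isIrreducible_twist (hρ.irreducible j) _
  faithful := by
    rintro ⟨g, c⟩ hgc
    have hne (j) : (χ ^ d j) c ≠ 0 := fun h => by
      have := nontrivial_of_isIrreducible (hρ.irreducible j)
      have h1 := hgc j
      rw [twist_apply, h, zero_smul] at h1
      exact zero_ne_one h1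
    have hg (j) : ρ j g = ((χ ^ d j) c)⁻¹ • 1 := by
      rw [← hgc j, twist_apply, smul_smul, inv_mul_cancel₀ (hne j), one_smul]
    have hg1 : g = 1 := by
      refine eq_one_of_coprime_card_center hcop (mem_center_of_scalar hρ hg) ?_
      refine hρ.faithful _ fun j => ?_
      rw [map_pow, hg, smul_pow, one_pow, inv_pow, ← map_pow, pow_eq_one_multiplicative_zmod,
        map_one, inv_one, one_smul]
    subst hg1
    obtain ⟨j, hj⟩ := hd
    have := nontrivial_of_isIrreducible (hρ.irreducible j)
    have h1 := hgc j
    rw [twist_apply, map_one] at h1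
    have h2 : (χ ^ d j) c = 1 := by
      obtain ⟨v, hv⟩ := exists_ne (0 : Fin (n j) → ℂ)
      have h3 := LinearMap.congr_fun h1 v
      simp only [LinearMap.smul_apply, Module.End.one_apply] at h3
      exact smul_left_injective ℂ hv (h3.trans (one_smul ℂ v).symm)
    have h3 : c ^ d j = 1 := hχ (by rw [map_pow, map_one]; exact h2)
    have h4 : c = 1 := by
      rw [← orderOf_eq_one_iff]
      exact Nat.eq_one_of_dvd_coprimes ((Nat.Prime.coprime_iff_not_dvd hp).2 hj)
        (orderOf_dvd_of_pow_eq_one (pow_eq_one_multiplicative_zmod c))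
        (orderOf_dvd_of_pow_eq_one h3)
    rw [h4]
    rfl

theorem exists_injective_character (p : ℕ) [NeZero p] :
    ∃ χ : Multiplicative (ZMod p) →* ℂ, Function.Injective χ :=
  ⟨(ZMod.stdAddChar (N := p)).toMonoidHom, ZMod.injective_stdAddChar⟩

end Twist

/-! ### Scalar actions and invariants of degree prime to `p` -/

section Scaling

variable {G : Type*} [Group G] {σ : Type}

/-- Diagonal substitutions compose by multiplying the scaling factors. -/
noncomputable def scaleHom (σ : Type*) :
    (σ → ℂ) →* (MvPolynomial σ ℂ →ₐ[ℂ] MvPolynomial σ ℂ) where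
  toFun := scale
  map_one' := by ext; simp
  map_mul' s t := by
    refine MvPolynomial.algHom_ext fun i => ?_
    simp [AlgHom.mul_apply, smul_smul, mul_comm]

theorem IsLinearAction.preservesWeight_one
    {τ : G →* (MvPolynomial σ ℂ →ₐ[ℂ] MvPolynomial σ ℂ)} (hτ : IsLinearAction τ) :
    PreservesWeight τ 1 := by
  intro g i
  have h : Submodule.span ℂ (Set.range (MvPolynomial.X (R := ℂ) (σ := σ))) ≤
      MvPolynomial.weightedHomogeneousSubmodule ℂ 1 1 := by
    refine Submodule.span_le.2 ?_
    rintro _ ⟨i, rfl⟩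
    exact MvPolynomial.isWeightedHomogeneous_X ℂ 1 i
  exact h (hτ g i)

theorem scale_const {f : MvPolynomial σ ℂ} {d : ℕ}
    (hf : MvPolynomial.IsWeightedHomogeneous 1 f d) (c : ℂ) :
    scale (fun _ => c) f = c ^ d • f := by
  have h := scale_of_isWeightedHomogeneous hf c
  simpa using h

theorem IsLinearAction.commute_scale
    {τ : G →* (MvPolynomial σ ℂ →ₐ[ℂ] MvPolynomial σ ℂ)} (hτ : IsLinearAction τ) (g : G) (c : ℂ) :
    Commute (τ g) (scaleHom σ fun _ => c) := by
  refine MvPolynomial.algHom_ext fun i => ?_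
  rw [AlgHom.mul_apply, AlgHom.mul_apply]
  change τ g (scale (fun _ => c) _) = scale (fun _ => c) _
  rw [scale_X, map_smul, scale_const (hτ.preservesWeight_one g i)]
  simp

/-- The action of a product with a group acting by scalars. -/
noncomputable def scalarAction {C : Type*} [Group C]
    (τ : G →* (MvPolynomial σ ℂ →ₐ[ℂ] MvPolynomial σ ℂ)) (hτ : IsLinearAction τ) (χ : C →* ℂ) :
    G × C →* (MvPolynomial σ ℂ →ₐ[ℂ] MvPolynomial σ ℂ) where
  toFun x := τ x.1 * scaleHom σ fun _ => χ x.2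
  map_one' := by
    simp only [Prod.fst_one, Prod.snd_one, map_one, one_mul]
    exact map_one (scaleHom σ)
  map_mul' x y := by
    have h : (scaleHom σ fun _ => χ (x * y).2) =
        (scaleHom σ fun _ => χ x.2) * scaleHom σ fun _ => χ y.2 := by
      rw [← map_mul]
      congr 1
      ext
      simp
    rw [h, Prod.fst_mul, map_mul, mul_assoc, mul_assoc, ← mul_assoc (τ y.1),
      (hτ.commute_scale y.1 _).eq, mul_assoc]

theorem isLinearAction_scalarAction {C : Type*} [Group C]
    {τ : G →* (MvPolynomial σ ℂ →ₐ[ℂ] MvPolynomial σ ℂ)} (hτ : IsLinearAction τ) (χ : C →* ℂ) :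
    IsLinearAction (scalarAction τ hτ χ) := by
  intro x i
  change τ x.1 (scale _ _) ∈ _
  rw [scale_X, map_smul]
  exact Submodule.smul_mem _ _ (hτ _ _)

theorem isEquivariant_scalarAction {C W : Type*} [Group C] [AddCommGroup W] [Module ℂ W]
    {τ : G →* (MvPolynomial σ ℂ →ₐ[ℂ] MvPolynomial σ ℂ)} (hτ : IsLinearAction τ) (χ : C →* ℂ)
    {ρ : Representation ℂ G W} {u : W →ₗ[ℂ] MvPolynomial σ ℂ} (hu : IsEquivariant τ ρ u) {d : ℕ}
    (hd : ∀ x, MvPolynomial.IsWeightedHomogeneous 1 (u x) d) :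
    IsEquivariant (scalarAction τ hτ χ) (twist ρ (χ ^ d)) u := by
  intro x w
  change _ = τ x.1 (scale _ _)
  rw [scale_const (hd w), twist_apply, LinearMap.smul_apply, map_smul, map_smul, hu]
  rfl

/-- Otherwise all invariants live in degrees divisible by `p` and are fixed by the scaling `μ` by
`ζ`. Then `∑ τ g = ∑ μ * τ g`, and Dedekind's theorem forces `μ = τ g` for some `g`. This `g` is
central with `g ^ p = 1`, hence trivial, although `ζ ≠ 1`. -/
theorem exists_homogeneous_invariant [Finite G] [Nontrivial G]
    {τ : G →* (MvPolynomial σ ℂ →ₐ[ℂ] MvPolynomial σ ℂ)} (hτ : IsLinearAction τ)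
    (hf : Function.Injective τ) {p : ℕ} (hp : p.Prime)
    (hcop : Nat.Coprime p (Nat.card (Subgroup.center G))) :
    ∃ (f : MvPolynomial σ ℂ) (e : ℕ), f ≠ 0 ∧ ¬ p ∣ e ∧
      MvPolynomial.IsWeightedHomogeneous 1 f e ∧ ∀ g, τ g f = f := by
  classical
  have := Fintype.ofFinite G
  have : NeZero p := ⟨hp.ne_zero⟩
  obtain ⟨χ, hχ⟩ := exists_injective_character p
  have hζ := isPrimitiveRoot_of_injective hχ
  set ζ := χ (Multiplicative.ofAdd 1)
  let μ := scaleHom σ fun _ => ζ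
  have hμp : μ ^ p = 1 := by
    rw [← map_pow, ← map_one (scaleHom σ)]
    congr 1
    ext
    simp [hζ.pow_eq_one]
  by_contra! hcon
  have hfix (f : MvPolynomial σ ℂ) (h : ∀ g, τ g f = f) : μ f = f := by
    have := scale_eq_smul (t := fun _ : σ => ζ) (f := f) (c := 1) fun m hm => by
      have hdeg : p ∣ Finsupp.weight (1 : σ → ℕ) m := by
        by_contra hnd
        obtain ⟨g, hg⟩ := hcon (MvPolynomial.weightedHomogeneousComponent 1
          (Finsupp.weight (1 : σ → ℕ) m) f) (Finsupp.weight (1 : σ → ℕ) m) (fun h0 => hm (by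
            have := congrArg (MvPolynomial.coeff m) h0
            rwa [MvPolynomial.coeff_weightedHomogeneousComponent, if_pos rfl] at this)) hnd
          (MvPolynomial.weightedHomogeneousComponent_isWeightedHomogeneous _ _)
        exact hg (by rw [← hτ.preservesWeight_one.component_apply, h g])
      rw [Finsupp.prod, Finset.prod_pow_eq_pow_sum, hζ.pow_eq_one_iff_dvd]
      simpa [Finsupp.weight_apply, Finsupp.sum] using hdeg
    rw [one_smul] at this
    exact this
  have hμ : ∃ g, τ g = μ := by
    by_contra! hne
    let ψ : G ⊕ G → (MvPolynomial σ ℂ →* MvPolynomial σ ℂ) :=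
      Sum.elim (fun g => ((τ g : _ →ₐ[ℂ] _) : _ →* _))
        (fun g => ((μ * τ g : _ →ₐ[ℂ] _) : _ →* _))
    have hcoe (a b : MvPolynomial σ ℂ →ₐ[ℂ] MvPolynomial σ ℂ)
        (h : (a : MvPolynomial σ ℂ →* MvPolynomial σ ℂ) = b) : a = b :=
      AlgHom.ext fun x => DFunLike.congr_fun h x
    have hmix (g h : G) : τ g ≠ μ * τ h := fun heq => hne (g * h⁻¹) (by
      rw [map_mul, heq, mul_assoc, ← map_mul, mul_inv_cancel, map_one, mul_one])
    have hψ : Function.Injective ψ := by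
      rintro (g | g) (h | h) heq
      · exact congrArg _ (hf (hcoe _ _ heq))
      · exact absurd (hcoe _ _ heq) (hmix g h)
      · exact absurd (hcoe _ _ heq).symm (hmix h g)
      · have h1 : μ * τ g = μ * τ h := hcoe _ _ heq
        have h2 : μ ^ (p - 1) * μ = 1 := by
          rw [← pow_succ, Nat.sub_add_cancel hp.one_le, hμp]
        refine congrArg _ (hf ?_)
        calc τ g = (μ ^ (p - 1) * μ) * τ g := by rw [h2, one_mul]
          _ = (μ ^ (p - 1) * μ) * τ h := by rw [mul_assoc, h1, mul_assoc]
          _ = τ h := by rw [h2, one_mul]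
    have hind := (linearIndependent_monoidHom (MvPolynomial σ ℂ) (MvPolynomial σ ℂ)).comp ψ hψ
    rw [Fintype.linearIndependent_iff] at hind
    have h1 := hind (Sum.elim (fun _ => 1) fun _ => -1) (by
      ext1 f
      have h2 : μ (∑ g, τ g f) = ∑ g, τ g f := hfix _ fun g => by
        rw [map_sum]
        refine Eq.trans (Finset.sum_congr rfl fun h _ => ?_)
          (Equiv.sum_comp (Equiv.mulLeft g) fun h => τ h f)
        rw [Equiv.coe_mulLeft, map_mul, AlgHom.mul_apply]
      rw [map_sum] at h2
      simp [ψ, AlgHom.mul_apply, h2]) (Sum.inl 1)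
    exact one_ne_zero h1
  obtain ⟨g, hg⟩ := hμ
  have hg1 : g = 1 := by
    refine eq_one_of_coprime_card_center hcop (Subgroup.mem_center_iff.2 fun h => hf ?_) (hf ?_)
    · rw [map_mul, map_mul, hg]
      exact hτ.commute_scale h ζ
    · rw [map_pow, hg, hμp, map_one]
  -- With `μ` the identity and `ζ ≠ 1` there can be no variables at all, so injectivity of `τ` would
  -- make `G` trivial.
  obtain ⟨h, hh⟩ := exists_ne (1 : G)
  refine hh (hf (MvPolynomial.algHom_ext fun i => ?_))
  have h2 : MvPolynomial.X i = ζ • MvPolynomial.X (R := ℂ) i := by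
    have h3 : μ (MvPolynomial.X i) = ζ • MvPolynomial.X i := scale_X _ i
    rwa [← hg, hg1, map_one, AlgHom.one_apply] at h3
  have h4 := congrArg (MvPolynomial.coeff (Finsupp.single i 1)) h2
  rw [MvPolynomial.coeff_smul, MvPolynomial.coeff_X, if_pos rfl, smul_eq_mul, mul_one] at h4
  exact absurd h4.symm (hζ.ne_one hp.one_lt)

end Scaling

/-! ### The case where `p` is prime to the order of the centre -/

section CoprimeDegree

variable {G : Type*} [Group G] {σ : Type}

/-- Multiplying homogeneous elements of degree `q * c` by the `c`-th powers of a fixed polynomial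
does not raise the transcendence degree. -/
theorem trdeg_adjoin_pow_mul_le (f : MvPolynomial σ ℂ) {q : ℕ} (hq : q ≠ 0)
    {s s' : Set (MvPolynomial σ ℂ)}
    (h : ∀ x ∈ s', ∃ y ∈ s, ∃ c, MvPolynomial.IsWeightedHomogeneous 1 y (q * c) ∧
      x = f ^ c * y) :
    Algebra.trdeg ℂ (Algebra.adjoin ℂ s') ≤ Algebra.trdeg ℂ (Algebra.adjoin ℂ s) := by
  refine trdeg_adjoin_le_of_forall _ _ fun t hts ht => ?_
  choose! y hy c hc hx using h
  refine mk_le_trdeg_of_forall_mem _ (x := fun i : t => y i) ?_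
    fun i => Algebra.subset_adjoin (hy _ (hts i.2))
  rw [algebraicIndependent_iff] at ht ⊢
  intro P hP
  -- A relation `P(y i) = 0` gives `P(y i * T ^ (q * c i)) = 0` by the coaction. Since `T ↦ T ^ q`
  -- is injective, `P(y i * T ^ c i) = 0`, and `T = f` yields a relation between the elements of
  -- `t`.
  let F : t → Polynomial (MvPolynomial σ ℂ) := fun i => Polynomial.C (y i) * Polynomial.X ^ c i
  let E : Polynomial (MvPolynomial σ ℂ) →ₐ[ℂ] Polynomial (MvPolynomial σ ℂ) :=
    (Polynomial.expand (MvPolynomial σ ℂ) q).restrictScalars ℂ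
  let ev : Polynomial (MvPolynomial σ ℂ) →ₐ[ℂ] MvPolynomial σ ℂ :=
    (Polynomial.aeval (R := MvPolynomial σ ℂ) f).restrictScalars ℂ
  have h1 : (E.comp (MvPolynomial.aeval F)) = (weightMap 1).comp
      (MvPolynomial.aeval fun i : t => y i) := by
    refine MvPolynomial.algHom_ext fun i => ?_
    rw [AlgHom.comp_apply, AlgHom.comp_apply, MvPolynomial.aeval_X, MvPolynomial.aeval_X,
      weightMap_of_isWeightedHomogeneous (hc _ (hts i.2))]
    simp [E, F, pow_mul]
  have h2 : MvPolynomial.aeval F P = 0 := by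
    have h3 := DFunLike.congr_fun h1 P
    rw [AlgHom.comp_apply, AlgHom.comp_apply, hP, map_zero] at h3
    exact Polynomial.expand_injective (Nat.pos_of_ne_zero hq) (h3.trans (map_zero _).symm)
  have h4 : ev.comp (MvPolynomial.aeval F) = MvPolynomial.aeval ((↑) : t → MvPolynomial σ ℂ) := by
    refine MvPolynomial.algHom_ext fun i => ?_
    rw [AlgHom.comp_apply, MvPolynomial.aeval_X, MvPolynomial.aeval_X, hx _ (hts i.2)]
    change Polynomial.aeval f (Polynomial.C _ * Polynomial.X ^ _) = _
    rw [map_mul, map_pow, Polynomial.aeval_C, Polynomial.aeval_X, mul_comm]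
    rfl
  refine ht P ?_
  rw [← h4, AlgHom.comp_apply, h2, map_zero]

theorem eq_C_of_isWeightedHomogeneous_zero {f : MvPolynomial σ ℂ}
    (hf : MvPolynomial.IsWeightedHomogeneous 1 f 0) : f = MvPolynomial.C (f.coeff 0) := by
  classical
  ext m
  rw [MvPolynomial.coeff_C]
  split_ifs with h
  · rw [h]
  · by_contra hm
    have h1 := hf hm
    simp only [Finsupp.weight_apply, Finsupp.sum, Pi.one_apply, smul_eq_mul, mul_one,
      Finset.sum_eq_zero_iff, Finsupp.mem_support_iff, ne_eq] at h1
    refine h (Finsupp.ext fun i => ?_)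
    by_contra h2
    exact h2 (h1 i (Ne.symm h2)).symm

theorem exists_pow_dvd_forall_of_ne_zero {J : Type*} {p : ℕ} (hp : p.Prime) (d : J → ℕ)
    (hd : ∃ j, d j ≠ 0) : ∃ (k : ℕ) (c : J → ℕ), (∀ j, d j = p ^ k * c j) ∧ ∃ j, ¬ p ∣ c j := by
  obtain ⟨j₀, hj₀⟩ := hd
  have hex : ∃ k, ¬ ∀ j, p ^ k ∣ d j :=
    ⟨d j₀, fun h => (Nat.lt_pow_self hp.one_lt).not_ge (Nat.le_of_dvd (Nat.pos_of_ne_zero hj₀)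
      (h j₀))⟩
  classical
  obtain ⟨K, hK, hmin⟩ : ∃ K, (¬ ∀ j, p ^ K ∣ d j) ∧ ∀ k < K, ∀ j, p ^ k ∣ d j :=
    ⟨Nat.find hex, Nat.find_spec hex, fun k hk => by simpa using Nat.find_min hex hk⟩
  cases K with
  | zero => exact absurd (fun j => by simp) hK
  | succ k =>
    choose c hc using hmin k k.lt_succ_self
    refine ⟨k, c, hc, ?_⟩
    by_contra! h
    refine hK fun j => ?_
    rw [hc j, pow_succ]
    exact Nat.mul_dvd_mul_left _ (h j)

/-- If all degrees were zero, the images would consist of constants, which `G` fixes, and `G` would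
be trivial. -/
theorem IsFaithfulFamily.exists_degree_ne_zero [Nontrivial G] {J : Type*} {n : J → ℕ}
    {ρ : ∀ j, Representation ℂ G (Fin (n j) → ℂ)} (hρ : IsFaithfulFamily ρ)
    {τ : G →* (MvPolynomial σ ℂ →ₐ[ℂ] MvPolynomial σ ℂ)}
    {u : ∀ j, (Fin (n j) → ℂ) →ₗ[ℂ] MvPolynomial σ ℂ} (hu : ∀ j, IsEquivariant τ (ρ j) (u j))
    (h0 : ∀ j, u j ≠ 0) {d : J → ℕ}
    (hd : ∀ j x, MvPolynomial.IsWeightedHomogeneous 1 (u j x) (d j)) : ∃ j, d j ≠ 0 := by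
  by_contra! h
  obtain ⟨g, hg⟩ := exists_ne (1 : G)
  refine hg (hρ.faithful g fun j => LinearMap.ext fun x => ?_)
  apply (hu j).injective (hρ.irreducible j) (h0 j)
  have h1 := hd j x
  rw [h j] at h1
  rw [hu, eq_C_of_isWeightedHomogeneous_zero h1, ← MvPolynomial.algebraMap_eq, AlgHom.commutes,
    MvPolynomial.algebraMap_eq, ← eq_C_of_isWeightedHomogeneous_zero h1]
  rfl

/-- Write `d j = p ^ k * c j` with some `c j` prime to `p`. If `k > 0`, multiplying `u j` by `f ^ c
j`, with `f` invariant of degree `e` prime to `p`, changes the degree to `c j * (e + p ^ k)`. The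
exponents are proportional to the degrees, which is why the transcendence degree does not grow. -/
theorem IsFaithfulFamily.exists_degree_not_dvd [Finite G] [Nontrivial G] {J : Type*} {n : J → ℕ}
    {ρ : ∀ j, Representation ℂ G (Fin (n j) → ℂ)} (hρ : IsFaithfulFamily ρ)
    {τ : G →* (MvPolynomial σ ℂ →ₐ[ℂ] MvPolynomial σ ℂ)} (hτ : IsLinearAction τ)
    (hinj : Function.Injective τ) {p : ℕ} (hp : p.Prime)
    (hcop : Nat.Coprime p (Nat.card (Subgroup.center G)))
    {u : ∀ j, (Fin (n j) → ℂ) →ₗ[ℂ] MvPolynomial σ ℂ} (hu : ∀ j, IsEquivariant τ (ρ j) (u j))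
    (h0 : ∀ j, u j ≠ 0) {d : J → ℕ}
    (hd : ∀ j x, MvPolynomial.IsWeightedHomogeneous 1 (u j x) (d j)) :
    ∃ (u' : ∀ j, (Fin (n j) → ℂ) →ₗ[ℂ] MvPolynomial σ ℂ) (d' : J → ℕ),
      (∀ j, IsEquivariant τ (ρ j) (u' j)) ∧ (∀ j, u' j ≠ 0) ∧
      (∀ j x, MvPolynomial.IsWeightedHomogeneous 1 (u' j x) (d' j)) ∧ (∃ j, ¬ p ∣ d' j) ∧
      Algebra.trdeg ℂ (imageAlgebra u') ≤ Algebra.trdeg ℂ (imageAlgebra u) := by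
  obtain ⟨k, c, hc, j₀, hj₀⟩ :=
    exists_pow_dvd_forall_of_ne_zero hp d (hρ.exists_degree_ne_zero hu h0 hd)
  rcases Nat.eq_zero_or_pos k with rfl | hk
  · exact ⟨u, d, hu, h0, hd, ⟨j₀, by simpa [hc] using hj₀⟩, le_rfl⟩
  obtain ⟨f, e, hf0, hpe, hfe, hf⟩ := exists_homogeneous_invariant hτ hinj hp hcop
  refine ⟨fun j => LinearMap.mulLeft ℂ (f ^ c j) ∘ₗ u j, fun j => c j * e + d j, fun j g x => ?_,
    fun j h => h0 j (LinearMap.ext fun x => ?_), fun j x => ?_, ⟨j₀, ?_⟩, ?_⟩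
  · simp only [LinearMap.comp_apply, LinearMap.mulLeft_apply, map_mul, map_pow, hf, hu j g x]
  · have h1 := LinearMap.congr_fun h x
    simp only [LinearMap.comp_apply, LinearMap.mulLeft_apply, LinearMap.zero_apply] at h1
    exact (mul_eq_zero.1 h1).resolve_left (pow_ne_zero _ hf0)
  · exact (hfe.pow _).mul (hd j x)
  · change ¬ p ∣ c j₀ * e + d j₀
    rw [hc, mul_comm (p ^ k), ← mul_add, hp.dvd_mul, not_or]
    exact ⟨hj₀, fun h => hpe ((Nat.dvd_add_left (dvd_pow_self p hk.ne')).1 h)⟩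
  · refine trdeg_adjoin_pow_mul_le f (pow_ne_zero k hp.ne_zero) ?_
    intro x hx
    obtain ⟨j, y, rfl⟩ := Set.mem_iUnion.1 hx
    exact ⟨u j y, Set.mem_iUnion.2 ⟨j, y, rfl⟩, c j, hc j ▸ hd j y, rfl⟩

theorem IsFaithfulSubalgebra.injective
    {τ : G →* (MvPolynomial σ ℂ →ₐ[ℂ] MvPolynomial σ ℂ)} {S : Subalgebra ℂ (MvPolynomial σ ℂ)}
    (hS : IsFaithfulSubalgebra τ S) : Function.Injective τ := by
  rw [injective_iff_map_eq_one]
  intro g hg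
  exact hS.faithful g fun s _ => by rw [hg, AlgHom.one_apply]

theorem IsFaithfulFamily.covdim_prod_eq_of_coprime [Finite G] [Nontrivial G] {J : Type*}
    {n : J → ℕ} {ρ : ∀ j, Representation ℂ G (Fin (n j) → ℂ)} (hρ : IsFaithfulFamily ρ)
    {p : ℕ} (hp : p.Prime) (hcop : Nat.Coprime p (Nat.card (Subgroup.center G))) :
    covdim (G × Multiplicative (ZMod p)) = covdim G := by
  have : NeZero p := ⟨hp.ne_zero⟩
  refine le_antisymm ?_ (covdim_le_of_injective (MonoidHom.inl G _) 
    (fun _ _ h => congrArg Prod.fst h))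
  obtain ⟨m, τ, S, hτ, hS, htr⟩ := exists_model_trdeg_eq_covdim G
  obtain ⟨u, hu, hu0, huS⟩ := hρ.exists_isEquivariant hS
  obtain ⟨u₁, h1, h2, h3, h4, -⟩ := exists_isWeightedHomogeneous hτ.preservesWeight_one hu hu0
  choose d hd using h4
  obtain ⟨u₂, d₂, g1, g2, g3, g4, g5⟩ := hρ.exists_degree_not_dvd hτ hS.injective hp hcop h1 h2 hd
  obtain ⟨χ, hχ⟩ := exists_injective_character p
  refine covdim_le_of_isFaithfulSubalgebra (scalarAction τ hτ χ) (isLinearAction_scalarAction hτ χ)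
    ((hρ.twist hp hcop hχ g4).isFaithfulSubalgebra
      (fun j => isEquivariant_scalarAction hτ χ (g1 j) (g3 j)) g2) ?_
  exact (g5.trans h3).trans ((trdeg_mono huS).trans htr.le)

end CoprimeDegree

/-! ### Simultaneous diagonalisation -/

section Eigenbasis

/-- Each `f i` is killed by the separable polynomial `X ^ p - 1`, so its generalised eigenspaces are
eigenspaces; by commutativity their joint intersections decompose `V`. -/
theorem exists_eigenbasis {V : Type} [AddCommGroup V] [Module ℂ V] [FiniteDimensional ℂ V]
    {I : Type*} {p : ℕ} (hp : p ≠ 0) (f : I → Module.End ℂ V)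
    (hcomm : ∀ i j, Commute (f i) (f j)) (hf : ∀ i, f i ^ p = 1) :
    ∃ (σ : Type) (_ : Fintype σ) (b : Module.Basis σ ℂ V) (μ : I → σ → ℂ),
      ∀ i k, f i (b k) = μ i k • b k := by
  classical
  have hss (i) : (f i).IsFinitelySemisimple := by
    rw [Module.End.isFinitelySemisimple_iff_isSemisimple]
    refine Module.End.isSemisimple_of_squarefree_aeval_eq_zero (p := Polynomial.X ^ p - 1) ?_ ?_
    · exact (Polynomial.separable_X_pow_sub_C 1 (by exact_mod_cast hp) one_ne_zero).squarefree
    · simp [hf]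
  let E (χ : I → ℂ) : Submodule ℂ V := ⨅ i, (f i).maxGenEigenspace (χ i)
  have hE : DirectSum.IsInternal E := by
    refine (DirectSum.isInternal_submodule_iff_iSupIndep_and_iSup_eq_top E).2 ⟨?_, ?_⟩
    · exact Module.End.independent_iInf_maxGenEigenspace_of_forall_mapsTo f fun i j φ =>
        Module.End.mapsTo_maxGenEigenspace_of_comm (hcomm j i) φ
    · exact Module.End.iSup_iInf_maxGenEigenspace_eq_top_of_iSup_maxGenEigenspace_eq_top_of_commute
        f (fun i j _ => hcomm i j) fun i => Module.End.iSup_maxGenEigenspace_eq_top (f i)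
  let b := hE.collectedBasis fun χ => Module.finBasis ℂ (E χ)
  have : Finite (Σ χ, Fin (Module.finrank ℂ (E χ))) := Module.Finite.finite_basis b
  -- The index type involves `I → ℂ`; reindexing by `Fin N` brings it into `Type`.
  obtain ⟨N, ⟨e⟩⟩ := Finite.exists_equiv_fin (Σ χ, Fin (Module.finrank ℂ (E χ)))
  refine ⟨Fin N, inferInstance, b.reindex e, fun i k => (e.symm k).1 i, fun i k => ?_⟩
  have hk := hE.collectedBasis_mem (fun χ => Module.finBasis ℂ (E χ)) (e.symm k)
  have hk' := (Submodule.mem_iInf _).1 hk i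
  rw [(hss i).maxGenEigenspace_eq_eigenspace, Module.End.mem_eigenspace_iff] at hk'
  rwa [Module.Basis.reindex_apply]

end Eigenbasis

/-! ### Upper bound by an additional variable -/

section ExtraVariable

variable {G C : Type*} [Group G] [Group C] {σ : Type}

/-- The action of a product on the polynomial ring with an additional variable, on which the second
factor acts by a character. -/
noncomputable def optionAction (τ : G →* (MvPolynomial σ ℂ →ₐ[ℂ] MvPolynomial σ ℂ)) (χ : C →* ℂ) :
    G × C →* (MvPolynomial (Option σ) ℂ →ₐ[ℂ] MvPolynomial (Option σ) ℂ) where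
  toFun x := MvPolynomial.aeval fun o => o.elim (χ x.2 • MvPolynomial.X none)
    fun i => MvPolynomial.rename some (τ x.1 (MvPolynomial.X i))
  map_one' := by
    refine MvPolynomial.algHom_ext fun o => ?_
    cases o <;> simp
  map_mul' x y := by
    have h (f : MvPolynomial σ ℂ) : MvPolynomial.aeval (fun o : Option σ =>
        o.elim (χ x.2 • MvPolynomial.X none)
          fun i => MvPolynomial.rename some (τ x.1 (MvPolynomial.X i)))
        (MvPolynomial.rename some f) = MvPolynomial.rename some (τ x.1 f) := by
      rw [MvPolynomial.aeval_rename]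
      change _ = ((MvPolynomial.rename some).comp (τ x.1)) f
      congr 1
      refine MvPolynomial.algHom_ext fun i => ?_
      simp
    refine MvPolynomial.algHom_ext fun o => ?_
    cases o with
    | none => simp [AlgHom.mul_apply, smul_smul, mul_comm]
    | some i =>
      rw [AlgHom.mul_apply, MvPolynomial.aeval_X, MvPolynomial.aeval_X]
      refine Eq.trans ?_ (h _).symm
      change MvPolynomial.rename some (τ (x.1 * y.1) _) = _
      rw [map_mul, AlgHom.mul_apply]

theorem optionAction_X_none (τ : G →* (MvPolynomial σ ℂ →ₐ[ℂ] MvPolynomial σ ℂ)) (χ : C →* ℂ)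
    (x : G × C) : optionAction τ χ x (MvPolynomial.X none) = χ x.2 • MvPolynomial.X none := by
  simp [optionAction]

theorem optionAction_rename (τ : G →* (MvPolynomial σ ℂ →ₐ[ℂ] MvPolynomial σ ℂ)) (χ : C →* ℂ)
    (x : G × C) (f : MvPolynomial σ ℂ) : optionAction τ χ x (MvPolynomial.rename some f) =
      MvPolynomial.rename some (τ x.1 f) := by
  change ((optionAction τ χ x).comp (MvPolynomial.rename some)) f =
    ((MvPolynomial.rename some).comp (τ x.1)) f
  congr 1
  refine MvPolynomial.algHom_ext fun i => ?_
  simp [optionAction]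

theorem isLinearAction_optionAction {τ : G →* (MvPolynomial σ ℂ →ₐ[ℂ] MvPolynomial σ ℂ)}
    (hτ : IsLinearAction τ) (χ : C →* ℂ) : IsLinearAction (optionAction τ χ) := by
  intro x o
  cases o with
  | none =>
    rw [optionAction_X_none]
    exact Submodule.smul_mem _ _ (Submodule.subset_span ⟨none, rfl⟩)
  | some i =>
    rw [← MvPolynomial.rename_X, optionAction_rename]
    have h : (Submodule.span ℂ (Set.range (MvPolynomial.X (R := ℂ) (σ := σ)))).map
        (MvPolynomial.rename some).toLinearMap ≤
        Submodule.span ℂ (Set.range (MvPolynomial.X (R := ℂ) (σ := Option σ))) := by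
      rw [Submodule.map_span]
      refine Submodule.span_mono ?_
      rintro _ ⟨_, ⟨i, rfl⟩, rfl⟩
      exact ⟨some i, by simp⟩
    exact h ⟨_, hτ x.1 i, rfl⟩

theorem covdim_prod_le_succ [Finite G] [Finite C] {χ : C →* ℂ} (hχ : Function.Injective χ) :
    covdim (G × C) ≤ covdim G + 1 := by
  obtain ⟨m, τ, S, hτ, hS, htr⟩ := exists_model_trdeg_eq_covdim G
  let r : MvPolynomial (Fin m) ℂ →ₐ[ℂ] MvPolynomial (Option (Fin m)) ℂ := MvPolynomial.rename some
  have hr : Function.Injective r := MvPolynomial.rename_injective _ (Option.some_injective _)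
  have hadj : Algebra.adjoin ℂ (r '' (S : Set (MvPolynomial (Fin m) ℂ))) = S.map r := by
    rw [← AlgHom.map_adjoin, Algebra.adjoin_eq]
  let T : Subalgebra ℂ (MvPolynomial (Option (Fin m)) ℂ) :=
    Algebra.adjoin ℂ (insert (MvPolynomial.X none) (r '' S))
  have hmem (s) (hs : s ∈ S) : r s ∈ T := Algebra.subset_adjoin (Or.inr ⟨s, hs, rfl⟩)
  have hX : MvPolynomial.X none ∈ T := Algebra.subset_adjoin (Or.inl rfl)
  refine covdim_le_of_isFaithfulSubalgebra (optionAction τ χ) (isLinearAction_optionAction hτ χ)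
    (S := T) ⟨fun x => ?_, fun x hx => ?_⟩ ?_
  · have h : T ≤ T.comap (optionAction τ χ x) := by
      refine Algebra.adjoin_le ?_
      rintro _ (rfl | ⟨s, hs, rfl⟩)
      · rw [SetLike.mem_coe, Subalgebra.mem_comap, optionAction_X_none]
        exact Subalgebra.smul_mem _ hX _
      · rw [SetLike.mem_coe, Subalgebra.mem_comap, optionAction_rename]
        exact hmem _ (hS.stable _ _ hs)
    exact h
  · have h1 : x.1 = 1 := hS.faithful _ fun s hs => hr (by
      have := hx _ (hmem s hs)
      rwa [optionAction_rename] at this)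
    have h2 : x.2 = 1 := hχ (by
      have h3 := hx _ hX
      rw [optionAction_X_none] at h3
      have h4 := congrArg (MvPolynomial.eval fun _ => (1 : ℂ)) h3
      simpa [MvPolynomial.smul_eval] using h4)
    exact Prod.ext h1 h2
  · refine (trdeg_adjoin_insert_le _ _).trans ?_
    rw [hadj, ← (S.equivMapOfInjective r hr).trdeg_eq, htr]
    simp

end ExtraVariable

/-- A faithful family of irreducible representations together with central elements, one for each
member of the family, acting on it by a fixed scalar and trivially on all other members. -/
structure IsCentralFamily {G J : Type*} [Group G] [DecidableEq J] {n : J → ℕ}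
    (ρ : ∀ j, Representation ℂ G (Fin (n j) → ℂ)) (z : J → G) (ζ : ℂ) : Prop
    extends IsFaithfulFamily ρ where
  central : ∀ i, z i ∈ Subgroup.center G
  apply_eq : ∀ i j, ρ j (z i) = (if i = j then ζ else 1) • 1

/-! ### Gradings and degrees coming from central elements -/

section Weights

variable {G J : Type*} [Group G] [DecidableEq J] {n : J → ℕ}
  {ρ : ∀ j, Representation ℂ G (Fin (n j) → ℂ)} {z : J → G} {ζ : ℂ}

theorem IsCentralFamily.pow_eq_one (h : IsCentralFamily ρ z ζ) {p : ℕ} (hζ : ζ ^ p = 1) (i : J) :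
    z i ^ p = 1 := by
  refine h.faithful _ fun j => ?_
  rw [map_pow, h.apply_eq, smul_pow, one_pow]
  split_ifs <;> simp [hζ]

theorem coeff_scale {σ : Type*} (t : σ → ℂ) (m : σ →₀ ℕ) (f : MvPolynomial σ ℂ) :
    MvPolynomial.coeff m (scale t f) = (m.prod fun i k => t i ^ k) * MvPolynomial.coeff m f := by
  classical
  induction f using MvPolynomial.induction_on' with
  | monomial u a =>
    rw [scale_monomial, MvPolynomial.coeff_smul, MvPolynomial.coeff_monomial, smul_eq_mul]
    split_ifs with h
    · rw [h]
    · simp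
  | add f g hf hg => rw [map_add, MvPolynomial.coeff_add, MvPolynomial.coeff_add, hf, hg, mul_add]

theorem exists_eq_single_of_mem_span {σ : Type*} {f : MvPolynomial σ ℂ}
    (hf : f ∈ Submodule.span ℂ (Set.range (MvPolynomial.X (R := ℂ) (σ := σ)))) (m : σ →₀ ℕ)
    (hm : MvPolynomial.coeff m f ≠ 0) : ∃ i, m = Finsupp.single i 1 := by
  classical
  induction hf using Submodule.span_induction with
  | mem x h =>
    obtain ⟨i, rfl⟩ := h
    refine ⟨i, ?_⟩
    by_contra hne
    exact hm (by rw [MvPolynomial.coeff_X, if_neg (Ne.symm hne)])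
  | zero => exact absurd (MvPolynomial.coeff_zero m) hm
  | add x y _ _ hx hy =>
    by_cases h : MvPolynomial.coeff m x = 0
    · exact hy (by rwa [MvPolynomial.coeff_add, h, zero_add] at hm)
    · exact hx h
  | smul a x _ hx =>
    exact hx fun h => hm (by rw [MvPolynomial.coeff_smul, h, smul_zero])

/-- Elements of the centre which act diagonally define gradings preserved by the action. -/
theorem preservesWeight_of_diagonal {σ : Type} {τ : G →* (MvPolynomial σ ℂ →ₐ[ℂ] MvPolynomial σ ℂ)}
    (hτ : IsLinearAction τ) {p : ℕ} (hζ : IsPrimitiveRoot ζ p) {g₀ : G}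
    (hg₀ : g₀ ∈ Subgroup.center G) {w : σ → ℕ} (hw : ∀ i, w i < p)
    (h : τ g₀ = scale fun i => ζ ^ w i) : PreservesWeight τ w := by
  intro g i m hm
  obtain ⟨l, rfl⟩ := exists_eq_single_of_mem_span (hτ g i) m hm
  -- Since `g₀` is central, `τ g` preserves the eigenspace of `τ g₀` containing `X i`.
  have h1 : scale (fun i => ζ ^ w i) (τ g (MvPolynomial.X i)) =
      ζ ^ w i • τ g (MvPolynomial.X i) := by
    rw [← h, ← AlgHom.mul_apply, ← map_mul, ← Subgroup.mem_center_iff.1 hg₀ g, map_mul,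
      AlgHom.mul_apply, h, scale_X, map_smul]
  have h2 := congrArg (MvPolynomial.coeff (Finsupp.single l 1)) h1
  rw [coeff_scale, MvPolynomial.coeff_smul, smul_eq_mul] at h2
  have h3 := mul_right_cancel₀ hm h2
  rw [Finsupp.prod_single_index (by simp), pow_one] at h3
  rw [Finsupp.weight_single, one_smul]
  -- Because the weights lie below `p`, equal eigenvalues mean equal weights, so the grading is by
  -- natural numbers and not only modulo `p`.
  exact hζ.pow_inj (hw l) (hw i) h3

/-- A linear model of minimal transcendence degree on which prescribed commuting elements act
diagonally. -/
theorem exists_diagonal_model {I : Type*} {z : I → G} [Finite G] {p : ℕ} (hp : p ≠ 0)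
    (hζ : IsPrimitiveRoot ζ p) (hz : ∀ i, z i ∈ Subgroup.center G) (hzp : ∀ i, z i ^ p = 1) :
    ∃ (σ : Type) (_ : Fintype σ) (τ : G →* (MvPolynomial σ ℂ →ₐ[ℂ] MvPolynomial σ ℂ))
      (S : Subalgebra ℂ (MvPolynomial σ ℂ)) (w : I → σ → ℕ), IsLinearAction τ ∧
        IsFaithfulSubalgebra τ S ∧ Algebra.trdeg ℂ S = covdim G ∧
        (∀ i k, w i k < p) ∧ ∀ i, τ (z i) = scale fun k => ζ ^ w i k := by
  have : NeZero p := ⟨hp⟩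
  obtain ⟨V, _, _, _, ρV, hV⟩ := exists_basis_model_trdeg_eq_covdim G
  have hpow (i) : ρV (z i)⁻¹ ^ p = 1 := by rw [← map_pow, inv_pow, hzp, inv_one, map_one]
  -- Inverses are diagonalised because `τ (z i)` acts on functions through `(z i)⁻¹`.
  obtain ⟨σ, _, b, μ, hμ⟩ := exists_eigenbasis hp (fun i => ρV (z i)⁻¹)
    (fun i j => by
      have : z i * z j = z j * z i := (Subgroup.mem_center_iff.1 (hz i) (z j)).symm
      have : Commute (z i)⁻¹ (z j)⁻¹ := Commute.inv_inv this
      exact this.map ρV) hpow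
  have hroot (i k) : ∃ w < p, ζ ^ w = μ i k := by
    refine hζ.eq_pow_of_pow_eq_one ?_
    have h (m : ℕ) : (ρV (z i)⁻¹ ^ m) (b k) = μ i k ^ m • b k := by
      induction m with
      | zero => simp
      | succ m ih => rw [pow_succ', Module.End.mul_apply, ih, map_smul, hμ, smul_smul, pow_succ]
    have h1 := h p
    rw [hpow, Module.End.one_apply] at h1
    exact smul_left_injective ℂ (b.ne_zero k) (h1.symm.trans (one_smul ℂ _).symm)
  choose w hw hwμ using hroot
  obtain ⟨S, hS, htr⟩ := hV b
  refine ⟨σ, inferInstance, basisAction b ρV, S, w, isLinearAction_basisAction b ρV, hS, htr, hw,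
    fun i => MvPolynomial.algHom_ext fun k => evalBasis_injective b (funext fun v => ?_)⟩
  rw [evalBasis_basisAction, scale_X, hwμ, map_smul, Pi.smul_apply, evalBasis_apply,
    evalBasis_apply, MvPolynomial.eval_X, MvPolynomial.eval_X]
  conv_lhs => rw [← b.sum_repr v]
  simp only [map_sum, map_smul, hμ, Finsupp.coe_finsetSum, Finset.sum_apply, Finsupp.smul_apply,
    smul_eq_mul, b.repr_self]
  rw [Finset.sum_eq_single k]
  · simp [mul_comm]
  · intro j _ hj
    simp [hj]
  · simp

/-- The degree matrix is congruent to the identity modulo `p`. -/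
theorem IsCentralFamily.degree_modEq (h : IsCentralFamily ρ z ζ) {σ : Type}
    {τ : G →* (MvPolynomial σ ℂ →ₐ[ℂ] MvPolynomial σ ℂ)} {p : ℕ} (hp : p ≠ 0)
    (hζ : IsPrimitiveRoot ζ p) {w : J → σ → ℕ} (hτ : ∀ i, τ (z i) = scale fun k => ζ ^ w i k)
    {u : ∀ j, (Fin (n j) → ℂ) →ₗ[ℂ] MvPolynomial σ ℂ} (hu : ∀ j, IsEquivariant τ (ρ j) (u j))
    (h0 : ∀ j, u j ≠ 0) {α : J → J → ℕ}
    (hα : ∀ i j x, MvPolynomial.IsWeightedHomogeneous (w i) (u j x) (α i j)) (i j : J) :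
    (α i j : ZMod p) = if i = j then 1 else 0 := by
  obtain ⟨x, hx⟩ : ∃ x, u j x ≠ 0 := by
    by_contra! hc
    exact h0 j (LinearMap.ext hc)
  -- The element `z i` acts on `u j x` by its scalar in `ρ j`, but also by `ζ ^ α i j` through
  -- homogeneity.
  have h1 := hu j (z i) x
  rw [hτ, scale_of_isWeightedHomogeneous (hα i j x), h.apply_eq, LinearMap.smul_apply, map_smul,
    Module.End.one_apply] at h1
  have h2 : (if i = j then ζ else 1) = ζ ^ α i j := smul_left_injective ℂ hx h1
  split_ifs at h2 ⊢
  · have h3 : ζ ^ ((α i j : ℤ) - 1) = 1 := by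
      rw [zpow_sub₀ (hζ.ne_zero hp), zpow_natCast, zpow_one, ← h2, div_self (hζ.ne_zero hp)]
    have h4 := (ZMod.intCast_zmod_eq_zero_iff_dvd _ p).2 ((hζ.zpow_eq_one_iff_dvd _).1 h3)
    push_cast at h4
    exact sub_eq_zero.1 h4
  · exact (ZMod.natCast_eq_zero_iff _ _).2 ((hζ.pow_eq_one_iff_dvd _).1 h2.symm)

/-- The determinant is one modulo `p`, hence nonzero; row `j₀` of the adjugate gives the
coefficients and `D` is the determinant. -/
theorem exists_int_combination [Fintype J] {p : ℕ} (hp : p.Prime) {α : J → J → ℕ}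
    (hα : ∀ i j, (α i j : ZMod p) = if i = j then 1 else 0) (j₀ : J) :
    ∃ (a : J → ℤ) (D : ℤ), D ≠ 0 ∧ ∀ j, ∑ i, a i * α i j = if j = j₀ then D else 0 := by
  have : Fact p.Prime := ⟨hp⟩
  let A : Matrix J J ℤ := Matrix.of fun i j => (α i j : ℤ)
  refine ⟨fun i => A.adjugate j₀ i, A.det, fun hdet => ?_, fun j => ?_⟩
  · have h1 : (Int.castRingHom (ZMod p)).mapMatrix A = 1 := by
      ext i j
      simp [A, hα, Matrix.one_apply]
    have h2 := congrArg Matrix.det h1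
    rw [← RingHom.map_det, hdet, map_zero, Matrix.det_one] at h2
    exact zero_ne_one h2
  · have h1 := congrFun (congrFun A.adjugate_mul j₀) j
    rw [Matrix.mul_apply] at h1
    simpa [A, Matrix.one_apply, eq_comm] using h1

end Weights

/-! ### Transcendence from a one-parameter torus -/

section Torus

theorem prod_zpow_pow {I : Type*} {c : ℂ} (hc : c ≠ 0) (s : Finset I) (a : I → ℤ) (α : I → ℕ) :
    ∏ i ∈ s, (c ^ a i) ^ α i = c ^ ∑ i ∈ s, a i * α i := by
  classical
  induction s using Finset.induction_on with
  | empty => simp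
  | insert i s hi ih =>
    rw [Finset.prod_insert hi, Finset.sum_insert hi, zpow_add₀ hc, ih, zpow_mul, zpow_natCast]

/-- An algebraic equation for `y` over an algebra fixed by every `θ` would also be satisfied by all
multiples `c ^ D • y`, which is too many roots. -/
theorem transcendental_of_scale {R : Type*} [CommRing R] [IsDomain R] [Algebra ℂ R] {s : Set R}
    {y : R} (hy : y ≠ 0) {D : ℤ} (hD : D ≠ 0)
    (h : ∀ c : ℂ, c ≠ 0 → ∃ θ : R →ₐ[ℂ] R, (∀ x ∈ s, θ x = x) ∧ θ y = c ^ D • y) :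
    Transcendental (Algebra.adjoin ℂ s) y := by
  rw [transcendental_iff]
  intro Q hQ
  have hroot (c : ℂ) (hc : c ≠ 0) : Polynomial.aeval (c ^ D • y) Q = 0 := by
    obtain ⟨θ, hθ, hθy⟩ := h c hc
    have hfix : (θ : R →+* R).comp (algebraMap (Algebra.adjoin ℂ s) R) =
        algebraMap (Algebra.adjoin ℂ s) R := by
      have hle : Algebra.adjoin ℂ s ≤ AlgHom.equalizer θ (AlgHom.id ℂ R) := Algebra.adjoin_le hθ
      ext x
      exact hle x.2
    have h1 := congrArg (θ : R →+* R) hQ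
    rw [Polynomial.aeval_def, Polynomial.hom_eval₂, hfix, map_zero] at h1
    rw [Polynomial.aeval_def, ← hθy]
    exact h1
  have hinj : Function.Injective (algebraMap (Algebra.adjoin ℂ s) R) := Subtype.val_injective
  refine Polynomial.map_injective _ hinj ?_
  rw [Polynomial.map_zero]
  refine Polynomial.eq_zero_of_infinite_isRoot _ ?_
  -- The scalars `c = 2 ^ m` have distinct norms, and `D ≠ 0` keeps the values `c ^ D` distinct.
  refine Set.infinite_of_injective_forall_mem (f := fun m : ℕ => ((2 : ℂ) ^ m) ^ D • y) ?_ ?_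
  · intro m m' hm
    have h1 : ((2 : ℂ) ^ m) ^ D = ((2 : ℂ) ^ m') ^ D := smul_left_injective ℂ hy hm
    have h2 := congrArg norm h1
    simp only [norm_zpow, norm_pow, Complex.norm_ofNat] at h2
    have h3 : (2 : ℝ) ^ m = 2 ^ m' := (zpow_left_inj₀ (by positivity) (by positivity) hD).1 h2
    exact pow_right_injective₀ (by norm_num) (by norm_num) h3
  · intro m
    change Polynomial.IsRoot _ _
    rw [Polynomial.IsRoot.def, Polynomial.eval_map_algebraMap]
    exact hroot _ (pow_ne_zero m two_ne_zero)

theorem trdeg_add_one_le_of_transcendental {R : Type*} [CommRing R] [IsDomain R] [Algebra ℂ R]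
    {s : Set R} {T : Subalgebra ℂ R} {y : R} (hs : s ⊆ T) (hyT : y ∈ T)
    (hy : Transcendental (Algebra.adjoin ℂ s) y) :
    Algebra.trdeg ℂ (Algebra.adjoin ℂ s) + 1 ≤ Algebra.trdeg ℂ T := by
  obtain ⟨t, hts, ht, hc⟩ := exists_algebraicIndependent_subset_mk_eq_trdeg_adjoin (k := ℂ) s
  have hle : Algebra.adjoin ℂ (Set.range ((↑) : t → R)) ≤ Algebra.adjoin ℂ s := by
    rw [Subtype.range_coe]
    exact Algebra.adjoin_mono hts
  have hy' : Transcendental (Algebra.adjoin ℂ (Set.range ((↑) : t → R))) y := by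
    rw [transcendental_iff] at hy ⊢
    intro Q hQ
    have h1 := hy (Q.map (Subalgebra.inclusion hle).toRingHom) (by
      rw [Polynomial.aeval_def, Polynomial.eval₂_map]
      exact hQ)
    exact Polynomial.map_injective _ (Subalgebra.inclusion_injective hle)
      (h1.trans (Polynomial.map_zero _).symm)
  have h1 := (ht.option_iff_transcendental y).2 hy'
  have h2 := mk_le_trdeg_of_forall_mem T h1 fun o => by
    cases o with
    | none => exact hyT
    | some i => exact hs (hts i.2)
  rwa [mk_option, hc] at h2

end Torus

/-! ### Removing one member of a central family -/

section Descent

variable {G J : Type*} [Group G] [Finite G] [Fintype J] [DecidableEq J] {n : Option J → ℕ}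
  {ρ : ∀ j, Representation ℂ G (Fin (n j) → ℂ)} {z : Option J → G} {ζ : ℂ}

/-- Once all `u j` are homogeneous for all the gradings, combining these with exponents `a i` gives
a torus that scales `u none` by `c ^ D` and fixes the other `u j`. A nonzero value of `u none` is
therefore transcendental over the algebra generated by the others. -/
theorem IsCentralFamily.exists_model_some (h : IsCentralFamily ρ z ζ) {p : ℕ} (hp : p.Prime)
    (hζ : IsPrimitiveRoot ζ p) :
    ∃ (σ : Type) (_ : Fintype σ) (τ : G →* (MvPolynomial σ ℂ →ₐ[ℂ] MvPolynomial σ ℂ))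
      (u : ∀ j : J, (Fin (n (some j)) → ℂ) →ₗ[ℂ] MvPolynomial σ ℂ), IsLinearAction τ ∧
        (∀ j, IsEquivariant τ (ρ (some j)) (u j)) ∧ (∀ j, u j ≠ 0) ∧
        Algebra.trdeg ℂ (imageAlgebra u) + 1 ≤ covdim G := by
  obtain ⟨σ, _, τ, S, w, hτ, hS, htr, hwp, hw⟩ :=
    exists_diagonal_model hp.ne_zero hζ h.central (h.pow_eq_one hζ.pow_eq_one)
  obtain ⟨u₀, h1, h2, h3⟩ := h.toIsFaithfulFamily.exists_isEquivariant hS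
  obtain ⟨u, hu, hu0, hutr, hα⟩ := exists_forall_isWeightedHomogeneous
    (fun i => preservesWeight_of_diagonal hτ hζ (h.central i) (hwp i) (hw i)) h1 h2
  choose α hα using hα
  obtain ⟨a, D, hD, haD⟩ := exists_int_combination hp (h.degree_modEq hp.ne_zero hζ hw hu hu0 hα) none
  obtain ⟨x, hx⟩ : ∃ x, u none x ≠ 0 := by
    by_contra! hc
    exact hu0 none (LinearMap.ext hc)
  have hscale (c : ℂ) (hc : c ≠ 0) (j x) :
      scale (fun k => ∏ i, (c ^ a i) ^ w i k) (u j x) =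
        c ^ (if j = none then D else 0) • u j x := by
    rw [scale_of_forall_isWeightedHomogeneous (fun i => hα i j x), ← haD]
    rw [prod_zpow_pow hc]
  refine ⟨σ, inferInstance, τ, fun j => u (some j), hτ, fun j => hu _, fun j => hu0 _, ?_⟩
  have htrans : Transcendental (imageAlgebra fun j : J => u (some j)) (u none x) := by
    refine transcendental_of_scale hx hD fun c hc => ⟨_, ?_, (hscale c hc none x).trans (by simp)⟩
    intro y hy
    obtain ⟨j, x', rfl⟩ := Set.mem_iUnion.1 hy
    simpa using hscale c hc (some j) x'
  have h4 := trdeg_add_one_le_of_transcendental (T := imageAlgebra u) (by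
    intro y hy
    obtain ⟨j, x', rfl⟩ := Set.mem_iUnion.1 hy
    exact mem_imageAlgebra u (some j) x') (mem_imageAlgebra u none x) htrans
  exact h4.trans (hutr.trans ((trdeg_mono h3).trans htr.le))

end Descent

/-! ### Adding one cyclic factor -/

section OptionFamily

variable {G C J : Type*} [Group G] [Group C] {n : J → ℕ}

theorem isIrreducible_trivial_fin_one :
    (Representation.trivial ℂ G (Fin 1 → ℂ)).IsIrreducible := by
  have hnt : Nontrivial (Subrepresentation (Representation.trivial ℂ G (Fin 1 → ℂ))) :=
    ⟨⊥, ⊤, fun h => bot_ne_top (congrArg Subrepresentation.toSubmodule h)⟩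
  have hs : IsSimpleModule ℂ (Fin 1 → ℂ) := isSimpleModule_iff_finrank_eq_one.2 (by simp)
  refine { eq_bot_or_eq_top := fun K => ?_ }
  rcases eq_bot_or_eq_top K.toSubmodule with h | h
  · exact Or.inl (Subrepresentation.toSubmodule_injective h)
  · exact Or.inr (Subrepresentation.toSubmodule_injective h)

/-- A family of representations of `G` together with a character of `C`, as a family of
representations of `G × C`. -/
def optionFamily (ρ : ∀ j, Representation ℂ G (Fin (n j) → ℂ)) (χ : C →* ℂ) :
    ∀ o : Option J, Representation ℂ (G × C) (Fin (o.elim 1 n) → ℂ)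
  | none => twist (Representation.trivial ℂ G (Fin 1 → ℂ)) χ
  | some j => twist (ρ j) 1

theorem IsFaithfulFamily.option {ρ : ∀ j, Representation ℂ G (Fin (n j) → ℂ)}
    (hρ : IsFaithfulFamily ρ) {χ : C →* ℂ} (hχ : Function.Injective χ) :
    IsFaithfulFamily (optionFamily ρ χ) where
  irreducible
    | none => isIrreducible_twist isIrreducible_trivial_fin_one χ
    | some j => isIrreducible_twist (hρ.irreducible j) 1
  faithful x hx := by
    refine Prod.ext (hρ.faithful _ fun j => ?_) (hχ ?_)
    · have h : (1 : C →* ℂ) x.2 • ρ j x.1 = 1 := hx (some j)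
      simpa using h
    · have h : χ x.2 • Representation.trivial ℂ G (Fin 1 → ℂ) x.1 = 1 := hx none
      have h1 := congrFun (LinearMap.congr_fun h fun _ => 1) 0
      simpa using h1

/-- The central element attached to the new member comes from the new factor, so the hypothesis
passes to the product and the argument can be iterated. -/
theorem IsCentralFamily.option [DecidableEq J] {ρ : ∀ j, Representation ℂ G (Fin (n j) → ℂ)}
    {z : J → G} {χ : C →* ℂ} {c : C} (h : IsCentralFamily ρ z (χ c)) (hc : c ∈ Subgroup.center C)
    (hχ : Function.Injective χ) :
    IsCentralFamily (optionFamily ρ χ) (fun o => o.elim (1, c) fun j => (z j, 1)) (χ c) where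
  toIsFaithfulFamily := h.toIsFaithfulFamily.option hχ
  central
    | none => Subgroup.mem_center_iff.2 fun x =>
        Prod.ext (by simp) (Subgroup.mem_center_iff.1 hc x.2)
    | some j => Subgroup.mem_center_iff.2 fun x =>
        Prod.ext (Subgroup.mem_center_iff.1 (h.central j) x.1) (by simp)
  apply_eq
    | none, none => by
      rw [if_pos rfl]
      rfl
    | none, some j => by
      rw [if_neg (by simp), one_smul]
      change (1 : C →* ℂ) c • ρ j 1 = 1
      simp
    | some i, none => by
      rw [if_neg (by simp), one_smul]
      change χ 1 • Representation.trivial ℂ G (Fin 1 → ℂ) (z i) = 1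
      rw [map_one, one_smul]
      rfl
    | some i, some j => by
      change (1 : C →* ℂ) 1 • ρ j (z i) =
        (if some i = some j then χ c else 1) • (1 : Module.End ℂ (Fin (n j) → ℂ))
      simp only [map_one, one_smul, h.apply_eq, Option.some.injEq]

variable [Finite G] [Fintype J] [DecidableEq J]

/-- For the lower bound, delete from a minimal model of the product the member carrying `χ`. What
remains, restricted to `G`, is still faithful and has transcendence degree at least one less. -/
theorem IsCentralFamily.covdim_prod_eq {p : ℕ} (hp : p.Prime)
    {ρ : ∀ j, Representation ℂ G (Fin (n j) → ℂ)} {z : J → G}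
    {χ : Multiplicative (ZMod p) →* ℂ} (hχ : Function.Injective χ)
    (h : IsCentralFamily ρ z (χ (Multiplicative.ofAdd 1))) :
    covdim (G × Multiplicative (ZMod p)) = covdim G + 1 := by
  have : NeZero p := ⟨hp.ne_zero⟩
  refine le_antisymm (covdim_prod_le_succ hχ) ?_
  obtain ⟨σ, _, τ, u, hτ, hu, hu0, htr⟩ :=
    (h.option (Subgroup.mem_center_iff.2 fun _ => mul_comm _ _) hχ).exists_model_some hp
      (isPrimitiveRoot_of_injective hχ)
  have hS := h.toIsFaithfulFamily.isFaithfulSubalgebra (τ := τ.comp (MonoidHom.inl G _)) (u := u)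
    (fun j g w => by
      have h1 := hu j (g, 1) w
      have h2 : optionFamily ρ χ (some j) (g, 1) = ρ j g := by
        change (1 : Multiplicative (ZMod p) →* ℂ) 1 • ρ j g = _
        simp
      rw [h2] at h1
      exact h1) hu0
  have hlt : Algebra.trdeg ℂ (imageAlgebra u) < ℵ₀ :=
    (self_le_add_right _ 1).trans_lt (htr.trans_lt (natCast_lt_aleph0))
  obtain ⟨d, hd⟩ := lt_aleph0.1 hlt
  have h3 : covdim G ≤ d := covdim_le_of_isFaithfulSubalgebra _ (fun g => hτ (g, 1)) hS hd.le
  rw [hd] at htr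
  have h4 : d + 1 ≤ covdim (G × Multiplicative (ZMod p)) := by exact_mod_cast htr
  omega

end OptionFamily

/-! ### Adding several cyclic factors -/

section Powers

/-- Splitting off one factor of a power. -/
def prodPowSuccEquiv (G A : Type*) [Group G] [Group A] (m : ℕ) :
    G × (Fin (m + 1) → A) ≃* (G × A) × (Fin m → A) where
  toFun x := ((x.1, x.2 0), fun i => x.2 i.succ)
  invFun x := (x.1.1, Fin.cons x.1.2 x.2)
  left_inv x := Prod.ext rfl (Fin.cons_self_tail x.2)
  right_inv _ := rfl
  map_mul' _ _ := rfl

/-- The group and its family are quantified after `m`, since the induction replaces `G` by its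
product with one cyclic factor. -/
theorem covdim_prod_pow_eq {p : ℕ} (hp : p.Prime) {χ : Multiplicative (ZMod p) →* ℂ}
    (hχ : Function.Injective χ) (m : ℕ) :
    ∀ {G : Type*} [Group G] [Finite G] {J : Type} [Fintype J] [DecidableEq J] {n : J → ℕ}
      {ρ : ∀ j, Representation ℂ G (Fin (n j) → ℂ)} {z : J → G}
      (_ : IsCentralFamily ρ z (χ (Multiplicative.ofAdd 1))),
      covdim (G × (Fin m → Multiplicative (ZMod p))) = covdim G + m := by
  have : NeZero p := ⟨hp.ne_zero⟩
  induction m with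
  | zero =>
    intro G _ _ J _ _ n ρ z _
    exact covdim_congr MulEquiv.prodUnique
  | succ m ih =>
    intro G _ _ J _ _ n ρ z h
    rw [covdim_congr (prodPowSuccEquiv G _ m),
      ih (h.option (Subgroup.mem_center_iff.2 fun _ => mul_comm _ _) hχ), h.covdim_prod_eq hp hχ]
    omega

end Powers

/-! ### Families attached to faithful groups and their products -/

section FaithfulGroups

theorem IsFaithfulGroup.exists_rep {G : Type*} [Group G] (h : IsFaithfulGroup G) :
    ∃ (n : ℕ) (ρ : Representation ℂ G (Fin n → ℂ)), ρ.IsIrreducible ∧ Function.Injective ρ := by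
  obtain ⟨V, _, _, _, ρ, hρ, hinj⟩ := h
  have := nontrivial_of_isIrreducible hρ
  let e : V ≃ₗ[ℂ] (Fin (Module.finrank ℂ V) → ℂ) := (Module.finBasis ℂ V).equivFun
  let θ : Representation ℂ G (Fin (Module.finrank ℂ V) → ℂ) :=
    ((e.conjAlgEquiv ℂ : Module.End ℂ V →* _)).comp ρ
  have hθ (g v) : θ g (e v) = e (ρ g v) := by
    change e (ρ g (e.symm (e v))) = _
    rw [e.symm_apply_apply]
  refine ⟨_, θ, ?_, (e.conjAlgEquiv ℂ).injective.comp hinj⟩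
  have : Nontrivial (Fin (Module.finrank ℂ V) → ℂ) := e.symm.toEquiv.nontrivial
  have hnt : Nontrivial (Subrepresentation θ) :=
    ⟨⊥, ⊤, fun h => bot_ne_top (congrArg Subrepresentation.toSubmodule h)⟩
  refine { eq_bot_or_eq_top := fun K => ?_ }
  let K' : Subrepresentation ρ := ⟨K.toSubmodule.comap (e : V →ₗ[ℂ] _), fun g v hv => by
    have := K.apply_mem_toSubmodule g hv
    rw [Submodule.mem_comap]
    exact hθ g v ▸ this⟩
  have hmap : K.toSubmodule = (K.toSubmodule.comap (e : V →ₗ[ℂ] _)).map (e : V →ₗ[ℂ] _) :=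
    (Submodule.map_comap_eq_of_surjective e.surjective _).symm
  rcases hρ.eq_bot_or_eq_top K' with h | h
  · refine Or.inl (Subrepresentation.toSubmodule_injective ?_)
    have h1 : K.toSubmodule.comap (e : V →ₗ[ℂ] _) = ⊥ := congrArg Subrepresentation.toSubmodule h
    rw [hmap, h1, Submodule.map_bot]
    rfl
  · refine Or.inr (Subrepresentation.toSubmodule_injective ?_)
    have h1 : K.toSubmodule.comap (e : V →ₗ[ℂ] _) = ⊤ := congrArg Subrepresentation.toSubmodule h
    rw [hmap, h1, Submodule.map_top, LinearEquiv.range]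
    rfl

theorem exists_eq_smul_one_of_mem_center {G W : Type*} [Group G] [AddCommGroup W] [Module ℂ W]
    [FiniteDimensional ℂ W] {ρ : Representation ℂ G W} (hρ : ρ.IsIrreducible) {g : G}
    (hg : g ∈ Subgroup.center G) : ∃ a : ℂ, ρ g = a • 1 := by
  have := nontrivial_of_isIrreducible hρ
  obtain ⟨a, ha⟩ := Module.End.exists_eigenvalue (ρ g)
  refine ⟨a, ?_⟩
  let K : Subrepresentation ρ := ⟨Module.End.eigenspace (ρ g) a, fun h v hv => by
    rw [Module.End.mem_eigenspace_iff] at hv ⊢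
    rw [← Module.End.mul_apply, ← map_mul, ← Subgroup.mem_center_iff.1 hg h, map_mul,
      Module.End.mul_apply, hv, map_smul]⟩
  rcases hρ.eq_bot_or_eq_top K with h | h
  · exact absurd (congrArg Subrepresentation.toSubmodule h :) ha
  · ext1 v
    have hv : v ∈ Module.End.eigenspace (ρ g) a := by
      have h1 : Module.End.eigenspace (ρ g) a = ⊤ := congrArg Subrepresentation.toSubmodule h
      rw [h1]
      trivial
    exact Module.End.mem_eigenspace_iff.1 hv

/-- By Cauchy the centre has an element of order `p`, acting by a scalar. Faithfulness makes that
scalar a primitive `p`-th root of unity, of which `ζ` is a power. -/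
theorem exists_mem_center_eq_smul_one {G W : Type*} [Group G] [Finite G] [AddCommGroup W]
    [Module ℂ W] [FiniteDimensional ℂ W] {ρ : Representation ℂ G W} (hρ : ρ.IsIrreducible)
    (hinj : Function.Injective ρ) {p : ℕ} (hp : p.Prime)
    (hdvd : p ∣ Nat.card (Subgroup.center G)) {ζ : ℂ} (hζ : ζ ^ p = 1) :
    ∃ z ∈ Subgroup.center G, ρ z = ζ • 1 := by
  have : Fact p.Prime := ⟨hp⟩
  have : NeZero p := ⟨hp.ne_zero⟩
  have := nontrivial_of_isIrreducible hρ
  obtain ⟨⟨x, hx⟩, hxp⟩ := exists_prime_orderOf_dvd_card' p hdvd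
  rw [Subgroup.orderOf_mk] at hxp
  obtain ⟨a, ha⟩ := exists_eq_smul_one_of_mem_center hρ hx
  have hord : orderOf a = p := by
    refine orderOf_eq_prime ?_ fun h1 => ?_
    · have h1 : ρ (x ^ p) = 1 := by rw [← hxp, pow_orderOf_eq_one, map_one]
      rw [map_pow, ha, smul_pow, one_pow] at h1
      obtain ⟨v, hv⟩ := exists_ne (0 : W)
      exact smul_left_injective ℂ hv ((LinearMap.congr_fun h1 v).trans (one_smul ℂ v).symm)
    · rw [h1, one_smul, ← map_one ρ] at ha
      rw [hinj ha, orderOf_one] at hxp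
      exact hp.one_lt.ne hxp
  obtain ⟨k, -, hk⟩ := (hord ▸ IsPrimitiveRoot.orderOf a :
    IsPrimitiveRoot a p).eq_pow_of_pow_eq_one hζ
  exact ⟨x ^ k, Subgroup.pow_mem _ hx k, by rw [map_pow, ha, smul_pow, one_pow, hk]⟩

theorem isFaithfulFamily_unit {G : Type*} [Group G] {n : ℕ}
    {ρ : Representation ℂ G (Fin n → ℂ)} (hρ : ρ.IsIrreducible) (hinj : Function.Injective ρ) :
    IsFaithfulFamily fun _ : Unit => ρ where
  irreducible _ := hρ
  faithful _ hg := hinj ((hg ()).trans (map_one ρ).symm)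

variable {I : Type*} {G : I → Type*} [∀ i, Group (G i)] {n : I → ℕ}

theorem isFaithfulFamily_pi {ρ : ∀ i, Representation ℂ (G i) (Fin (n i) → ℂ)}
    (hρ : ∀ i, (ρ i).IsIrreducible) (hinj : ∀ i, Function.Injective (ρ i)) :
    IsFaithfulFamily fun i => (ρ i).comp (Pi.evalMonoidHom G i) where
  irreducible i := by
    classical
    refine isIrreducible_of_stable (hρ i) fun K hK g v hv => ?_
    simpa using hK (Pi.mulSingle i g) v hv
  faithful g hg := funext fun i => hinj i ((hg i).trans (map_one (ρ i)).symm)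

theorem isCentralFamily_pi [DecidableEq I] {ρ : ∀ i, Representation ℂ (G i) (Fin (n i) → ℂ)}
    (hρ : ∀ i, (ρ i).IsIrreducible) (hinj : ∀ i, Function.Injective (ρ i)) {z : ∀ i, G i} {ζ : ℂ}
    (hz : ∀ i, z i ∈ Subgroup.center (G i)) (hζ : ∀ i, ρ i (z i) = ζ • 1) :
    IsCentralFamily (fun i => (ρ i).comp (Pi.evalMonoidHom G i)) (fun i => Pi.mulSingle i (z i))
      ζ where
  toIsFaithfulFamily := isFaithfulFamily_pi hρ hinj
  central i := Subgroup.mem_center_iff.2 fun g => funext fun j => by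
    rcases eq_or_ne j i with rfl | hj
    · simpa using Subgroup.mem_center_iff.1 (hz j) (g j)
    · simp [hj]
  apply_eq i j := by
    change ρ j (Pi.mulSingle (M := G) i (z i) j) = _
    rcases eq_or_ne i j with rfl | hj
    · simp [hζ]
    · simp [hj, hj.symm]

end FaithfulGroups

end CovariantDimension

/-! ### The main theorem -/

theorem corollary4p4 (p : ℕ) (hp : p.Prime) :
    (∀ (n : ℕ) (_ : 1 ≤ n) (G : Fin n → Type*) [∀ i, Group (G i)] [∀ i, Finite (G i)]
        [∀ i, Nontrivial (G i)] (_ : ∀ i, CovariantDimension.IsFaithfulGroup (G i)),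
      (Nat.Coprime p (Nat.card (Subgroup.center (∀ i, G i))) →
        CovariantDimension.covdim ((∀ i, G i) × Multiplicative (ZMod p)) =
          CovariantDimension.covdim (∀ i, G i)) ∧
      ((∀ i, p ∣ Nat.card (Subgroup.center (G i))) →
        ∀ m : ℕ, CovariantDimension.covdim ((∀ i, G i) × (Fin m → Multiplicative (ZMod p))) =
          CovariantDimension.covdim (∀ i, G i) + m)) ∧
    (∀ (H : Type*) [Group H] [Finite H] [Nontrivial H]
        (_ : CovariantDimension.IsFaithfulGroup H) (m : ℕ) (_ : 1 ≤ m),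
      (p ∣ Nat.card (Subgroup.center H) →
        CovariantDimension.covdim (H × (Fin m → Multiplicative (ZMod p))) =
          CovariantDimension.covdim H + m) ∧
      (¬ p ∣ Nat.card (Subgroup.center H) →
        CovariantDimension.covdim (H × (Fin m → Multiplicative (ZMod p))) =
          CovariantDimension.covdim H + (m - 1))) := by
  have : NeZero p := ⟨hp.ne_zero⟩
  obtain ⟨χ, hχ⟩ := CovariantDimension.exists_injective_character p
  have hζ := CovariantDimension.isPrimitiveRoot_of_injective hχ
  refine ⟨fun n hn G _ _ _ hG => ?_, fun H _ _ _ hH m hm => ?_⟩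
  · choose k ρ hρ hinj using fun i => (hG i).exists_rep
    -- With a nonempty index set the product is nontrivial, as the coprime case requires.
    have : NeZero n := ⟨by omega⟩
    refine ⟨fun hcop => (CovariantDimension.isFaithfulFamily_pi hρ hinj).covdim_prod_eq_of_coprime
      hp hcop, fun hdvd m => ?_⟩
    choose z hz hzζ using fun i => CovariantDimension.exists_mem_center_eq_smul_one (hρ i) (hinj i)
      hp (hdvd i) hζ.pow_eq_one
    exact CovariantDimension.covdim_prod_pow_eq hp hχ m
      (CovariantDimension.isCentralFamily_pi hρ hinj hz hzζ)
  · obtain ⟨k, ρ, hρ, hinj⟩ := hH.exists_rep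
    have hfam := CovariantDimension.isFaithfulFamily_unit hρ hinj
    refine ⟨fun hdvd => ?_, fun hdvd => ?_⟩
    · obtain ⟨z, hz, hzζ⟩ := CovariantDimension.exists_mem_center_eq_smul_one hρ hinj hp hdvd
        hζ.pow_eq_one
      exact CovariantDimension.covdim_prod_pow_eq hp hχ m
        (ρ := fun _ : Unit => ρ) (z := fun _ => z) ⟨hfam, fun _ => hz, fun _ _ => by simp [hzζ]⟩
    · have hcop := (Nat.Prime.coprime_iff_not_dvd hp).2 hdvd
      -- One factor is absorbed at no cost. The product of `H` with it has the faithful irreducible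
      -- representation `ρ` twisted by `χ`, whose generator of the cyclic factor acts by the
      -- required root of unity, so each remaining factor adds one.
      obtain ⟨m, rfl⟩ : ∃ l, m = l + 1 := ⟨m - 1, by omega⟩
      have htw := hfam.twist hp hcop hχ (d := fun _ => 1) ⟨(), by simpa using hp.one_lt.ne'⟩
      rw [CovariantDimension.covdim_congr (CovariantDimension.prodPowSuccEquiv H _ m),
        CovariantDimension.covdim_prod_pow_eq hp hχ m (z := fun _ : Unit =>
          ((1 : H), Multiplicative.ofAdd (1 : ZMod p))) ⟨htw, fun _ =>
            Subgroup.mem_center_iff.2 fun x => Prod.ext (by simp) (mul_comm _ _), fun _ _ => by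
              simp⟩, hfam.covdim_prod_eq_of_coprime hp hcop, Nat.add_sub_cancel]
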